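/- **Conventions.** A (connected) map $\mathcal M$, on a surface that may be non-compact, non-orientable or with boundary, is described by its non-empty set $\Phi$ of flags $\phi=(v,e,f)$ (mutually incident vertex, edge, face) with the permutations $r_0,r_1,r_2$ of $\Phi$ satisfying $r_i^2=(r_0r_2)^2=1$, generating a transitive group; $\phi r_i$ is the flag sharing with $\phi$ its components of dimension $j\ne i$ (or $\phi$ itself if there is no other such flag). Vertices, edges and faces are the orbits of $\langle r_1,r_2\rangle$, $\langle r_0,r_2\rangle$ and $\langle r_0,r_1\rangle$, and ${\rm Aut}\,\mathcal M$ is the centraliser of $\langle r_0,r_1,r_2\rangle$ in ${\rm Sym}\,\Phi$. The map is compact if $\Phi$ is finite; it is without boundary if no $r_i$ fixes a flag; it is orientable if the flags can be $2$-coloured so that $\phi$ and $\phi r_i$ have different colours whenever $\phi r_i\neq\phi$. It is just-edge-transitive if ${\rm Aut}\,\mathcal M$ is transitive on the edges, but neither on the vertices nor on the faces. A reflection of $\mathcal M$ is a non-identity automorphism sending some flag $\phi$ to some $\phi r_i$. For $m\ge 3$ and $k=1,2,3,4$ define $m_1,m_2,m_3,m_4$, with sum $4m$, to be respectively $$(m,m,m,m),\quad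 (m+1,m+1,m-1,m-1),\quad (m+2,m,m,m-2),\quad (m+3,m+1,m-1,m-3).$$ Let $n=4m+1$, $l=m_3+m_4-1$ and $t_j=(j,j+1)\in S_n$ for $1\le j\le 4m$. Label the edges $\{j,j+1\}$ of the path with vertices $1,\dots,n$ by elements of $\{1,2,3,4\}$ as follows: $j=1$ has label $3$; $j=2$ has label $1$ if $k\in\{3,4\}$ and label $2$ if $k\in\{1,2\}$; $j=3,\dots,l+1$ have labels alternately $3,4,3,4,\dots,3,4$; $j=l+2,\dots,4m-1$ have labels alternately $1,2,1,\dots,2,1$; $j=4m$ has label $3$ if $k\in\{3,4\}$ and label $4$ if $k\in\{1,2\}$. Let $s_i$ be the product of the transpositions $t_j$ over those $j$ for which $\{j,j+1\}$ has label $i$. Call $m$ *admissible* for $k$ if $m\ge3$, $n=4m+1$ is prime and all $m_i>0$ (so $m\ne 3$ if $k=4$). Say that $\mathcal M$ *realises* $(k,m)$ if there are a flag $\phi$ and reflections $a_1,a_2,a_3,a_4$ generating ${\rm Aut}\,\mathcal M$ such that, with $\phi_1=\phi$, $\phi_2=\phi r_2$, $\phi_3=\phi r_0r_2$, $\phi_4=\phi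 r_0$ (the four flags at an edge), $a_i$ sends $\phi_i$ to $\phi_ir_1$ for each $i$, and there is an isomorphism ${\rm Aut}\,\mathcal M\to\langle s_1,s_2,s_3,s_4\rangle$ with $a_i\mapsto s_i$ for each $i$. **Theorem 5.1.** Let $k\in\{1,2,3,4\}$. 1. There are infinitely many pairwise non-isomorphic orientable maps, and also infinitely many pairwise non-isomorphic non-orientable maps, that are compact, without boundary and just-edge-transitive, and whose automorphism group has exactly $k$ conjugacy classes of reflections. In both cases they can be chosen so that each of them realises $(k,m)$ for some $m$ admissible for $k$. 2. More precisely, let $m$ be admissible for $k$. Then each $s_i$ is an involution that is a product of $m_i$ disjoint transpositions; either all $m_i$ are odd and $\langle s_1,s_2,s_3,s_4\rangle=S_n$, or all $m_i$ are even and $\langle s_1,s_2,s_3,s_4\rangle=A_n$; and there is a map $\mathcal M$ realising $(k,m)$ which is compact, without boundary and just-edge-transitive, whose automorphism group (isomorphic to $S_n$ or $A_n$ accordingly) has exactly $k$ conjugacy classes of reflections, and which is orientable if and only if the $m_i$ are all odd. -/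

import Mathlib

/-- A connected map on a surface (compact or not, orientable or not, with or without boundary),
given by its flags: a transitive permutation representation of
`⟨R₀, R₁, R₂ | Rᵢ² = (R₀R₂)² = 1⟩` on the set of flags.
`r i φ` is the flag sharing with `φ` the components of dimension `j ≠ i` (vertex, edge, face being
of dimension `0, 1, 2`), or `φ` itself if there is no other such flag (at the boundary). -/
structure SurfaceMap where
  Flag : Type
  nonempty : Nonempty Flag
  r : Fin 3 → Equiv.Perm Flag
  r_sq : ∀ i, r i * r i = 1
  r_zero_two_sq : (r 0 * r 2) * (r 0 * r 2) = 1
  connected : MulAction.IsPretransitive (Subgroup.closure (Set.range r)) Flag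

namespace SurfaceMap

/-- The monodromy group. -/
def Mon (M : SurfaceMap) : Subgroup (Equiv.Perm M.Flag) := Subgroup.closure (Set.range M.r)

/-- The automorphism group: the centraliser of the monodromy group in the symmetric group
on the flags. -/
def Aut (M : SurfaceMap) : Subgroup (Equiv.Perm M.Flag) :=
  Subgroup.centralizer (M.Mon : Set (Equiv.Perm M.Flag))

/-- Isomorphism of maps: a bijection of the flags commuting with the generators. -/
def Isomorphic (M N : SurfaceMap) : Prop :=
  ∃ f : M.Flag ≃ N.Flag, ∀ i φ, f (M.r i φ) = N.r i (f φ)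

/-- The cells of dimension `i` (vertices, edges, faces for `i = 0, 1, 2`): the orbits on flags of
the subgroup generated by the two `r j` with `j ≠ i`. -/
def Cell (M : SurfaceMap) (i : Fin 3) : Type :=
  MulAction.orbitRel.Quotient (Subgroup.closure (M.r '' {j | j ≠ i})) M.Flag

/-- The cell of dimension `i` in the flag `φ`. -/
def cell (M : SurfaceMap) (i : Fin 3) (φ : M.Flag) : M.Cell i :=
  Quotient.mk _ φ

theorem aut_comm (M : SurfaceMap) (a : M.Aut) (i : Fin 3)
    (g : Subgroup.closure (M.r '' {j | j ≠ i})) (φ : M.Flag) : a • g • φ = g • a • φ := by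
  have hg : (g : Equiv.Perm M.Flag) ∈ M.Mon :=
    Subgroup.closure_mono (Set.image_subset_range _ _) g.2
  have h := (Subgroup.mem_centralizer_iff.1 a.2) g hg
  exact (DFunLike.congr_fun h φ).symm

/-- Automorphisms act on the cells of each dimension, compatibly with their action on flags. -/
instance (M : SurfaceMap) (i : Fin 3) : MulAction M.Aut (M.Cell i) where
  smul a := Quotient.map (fun φ => a • φ) (by
    rintro φ ψ ⟨g, rfl⟩
    exact ⟨g, (M.aut_comm a i g ψ).symm⟩)
  one_smul x := by
    induction x using Quotient.inductionOn with
    | _ φ => exact congrArg (Quotient.mk _) (one_smul M.Aut φ)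
  mul_smul a b x := by
    induction x using Quotient.inductionOn with
    | _ φ => exact congrArg (Quotient.mk _) (mul_smul a b φ)

theorem smul_cell (M : SurfaceMap) (i : Fin 3) (a : M.Aut) (φ : M.Flag) :
    a • M.cell i φ = M.cell i (a • φ) := rfl

def VertexTransitive (M : SurfaceMap) : Prop := MulAction.IsPretransitive M.Aut (M.Cell 0)

def EdgeTransitive (M : SurfaceMap) : Prop := MulAction.IsPretransitive M.Aut (M.Cell 1)

def FaceTransitive (M : SurfaceMap) : Prop := MulAction.IsPretransitive M.Aut (M.Cell 2)

/-- Edge-transitive, but neither vertex- nor face-transitive. -/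
def JustEdgeTransitive (M : SurfaceMap) : Prop :=
  M.EdgeTransitive ∧ ¬ M.VertexTransitive ∧ ¬ M.FaceTransitive

/-- A map is compact when it has finitely many flags. -/
def IsCompact (M : SurfaceMap) : Prop := Finite M.Flag

/-- A map has a boundary when some flag is fixed by some generator. -/
def HasBoundary (M : SurfaceMap) : Prop := ∃ i φ, M.r i φ = φ

/-- A map is orientable when its flags can be given one of two orientations each, such that
any two distinct flags that are adjacent under a generator have opposite orientations. -/
def Orientable (M : SurfaceMap) : Prop :=
  ∃ c : M.Flag → Bool, ∀ i φ, M.r i φ ≠ φ → c (M.r i φ) ≠ c φ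

/-- A reflection is a non-identity automorphism which sends some flag `φ` to one of its
neighbours `r i φ`, i.e. which acts near that flag as the reflection in one of its sides. -/
def IsReflection (M : SurfaceMap) (a : M.Aut) : Prop :=
  a ≠ 1 ∧ ∃ i φ, (a : Equiv.Perm M.Flag) φ = M.r i φ

/-- The number of conjugacy classes of reflections in the automorphism group. -/
noncomputable def cr (M : SurfaceMap) : ℕ :=
  Set.ncard {C : ConjClasses M.Aut | ∃ a, M.IsReflection a ∧ ConjClasses.mk a = C}

/-- The four flags at the edge of a flag `φ`, in the order `φ, φr₂, φr₀r₂, φr₀`. -/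
def edgeFlags (M : SurfaceMap) (φ : M.Flag) : Fin 4 → M.Flag :=
  ![φ, M.r 2 φ, M.r 2 (M.r 0 φ), M.r 0 φ]

end SurfaceMap

/-- The four summands `m₁, m₂, m₃, m₄` of `4m` (indexed by `0, 1, 2, 3`), taking `k` different
values, for `k = 1, 2, 3, 4`. -/
def pathParts (k m : ℕ) : Fin 4 → ℕ :=
  match k with
  | 1 => ![m, m, m, m]
  | 2 => ![m + 1, m + 1, m - 1, m - 1]
  | 3 => ![m + 2, m, m, m - 2]
  | _ => ![m + 3, m + 1, m - 1, m - 3]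

/-- The label (`0, 1, 2, 3` standing for `1, 2, 3, 4`) of the edge `{j, j + 1}`, `1 ≤ j ≤ 4m`, of
the path with vertices `1, …, 4m + 1`. With `l = m₃ + m₄ - 1`, the labels are
`3`; then `1` or `2`; then `3, 4, …, 3, 4` for `3 ≤ j ≤ l + 1`; then `1, 2, …, 2, 1` for
`l + 2 ≤ j ≤ 4m - 1`; then `3` or `4`. -/
def pathLabel (k m j : ℕ) : Fin 4 :=
  let p := pathParts k m
  let l := p 2 + p 3 - 1
  if j = 1 then 2
  else if j = 2 then (if p 0 = p 1 + 2 then 0 else 1)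
  else if j ≤ l + 1 then (if Even (j - 3) then 2 else 3)
  else if j < 4 * m then (if Even (j - (l + 2)) then 0 else 1)
  else (if p 2 = p 3 + 2 then 2 else 3)

/-- The permutation `sᵢ` of the vertices of the path: the product of the (disjoint)
transpositions `(j, j + 1)` over the edges `{j, j + 1}` with label `i`. The vertices `1, …, 4m + 1`
are numbered from `0` here, so that `j : Fin (4 * m)` stands for the edge `{j + 1, j + 2}`. -/
def pathPerm (k m : ℕ) (i : Fin 4) : Equiv.Perm (Fin (4 * m + 1)) :=
  ((List.finRange (4 * m)).map fun j : Fin (4 * m) =>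
    if pathLabel k m (j + 1) = i then Equiv.swap j.castSucc j.succ else 1).prod

/-- The parameters for which the labelled path is used: `n = 4m + 1` is a prime with `m ≥ 3`, and
all four of the summands are positive (for `k = 4` this excludes `m = 3`). -/
def PathAdmissible (k m : ℕ) : Prop :=
  3 ≤ m ∧ (4 * m + 1).Prime ∧ ∀ i, 0 < pathParts k m i

/-- The automorphism group of `M` is generated by four reflections `a i` acting, at the four flags
of some edge, as the reflections in the side `r 1`, and there is an isomorphism onto the
group generated by the permutations `sᵢ` of the labelled path taking each `a i` to `sᵢ`. -/
def SurfaceMap.IsPathMap (k m : ℕ) (M : SurfaceMap) : Prop :=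
  ∃ (φ : M.Flag) (a : Fin 4 → M.Aut),
    (∀ i, M.IsReflection (a i) ∧
      (a i : Equiv.Perm M.Flag) (M.edgeFlags φ i) = M.r 1 (M.edgeFlags φ i)) ∧
    Subgroup.closure (Set.range a) = ⊤ ∧
    ∃ e : M.Aut ≃* Subgroup.closure (Set.range (pathPerm k m)),
      ∀ i, (e (a i) : Equiv.Perm (Fin (4 * m + 1))) = pathPerm k m i

/-! Four involutions generating a group `G` give a map whose edges are the elements of `G`. Its
flags are pairs in `G × Fin 4`; `r 0` and `r 2` move the second coordinate (the sheet) by the Klein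
four-group, and `r 1` multiplies the first coordinate on the right by the involution named by the
sheet. Left multiplication acts by automorphisms and is transitive on edges. Any further
automorphism would induce a non-trivial Klein permutation of the generators extending to `G`;
`KleinRigid` excludes this by exhibiting relations that such a permutation destroys. Then `Aut` is
`G`, sheets are preserved, and so there is more than one orbit on vertices and on faces. The
reflections are the conjugates of the generators, and orientability means that `G` has a 2-colouring
changed by every generator.

For the labelled path (labels 0 to 3 in the code), `G` is transitive of prime degree, hence
primitive. In `(s 2 * s 3)^2` and `(s 0 * s 1)^2` the squaring kills the stray transpositions near
the ends of the path, so the two supports meet only at the vertex where the two long alternating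
stretches join. Their commutator is a 3-cycle, and Jordan's theorem gives the alternating group.

The rest is read off from cycle types. Each generator fixes at least two points, so conjugacy in `G`
is equality of cycle types and there are `k` classes. All `m_i` have the same parity: if odd, `G` is
symmetric and the sign is the required colouring; if even, `G` is alternating, and no colouring
exists because 3-cycles are squares. Dirichlet's theorem modulo 8 supplies infinitely many primes
`4m + 1` with `m` of either parity, and flag counts separate the maps. -/

/-! ### The Klein four-group on labels, and words in involutions -/

theorem fin_four_xor_xor_self (c i : Fin 4) : c ^^^ (c ^^^ i) = i := by
  revert c i; decide

/-- The translations by 1 and 3 generate the Klein group. They are the ones performed by `r 2` and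
`r 0`, so a property stable under both spreads over all four flags of an edge. -/
theorem klein_induction {P : Fin 4 → Prop} (h₁ : ∀ i, P i → P (1 ^^^ i))
    (h₃ : ∀ i, P i → P (3 ^^^ i)) {i : Fin 4} (hi : P i) (j : Fin 4) : P j := by
  have : j = i ∨ j = 1 ^^^ i ∨ j = 3 ^^^ i ∨ j = 3 ^^^ (1 ^^^ i) := by
    clear hi; revert i j; decide
  rcases this with rfl | rfl | rfl | rfl
  exacts [hi, h₁ _ hi, h₃ _ hi, h₃ _ (h₁ _ hi)]

theorem fin_four_xor_zero (i : Fin 4) : i ^^^ 0 = i := by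
  revert i; decide

/-- Translation by `c` in the Klein four-group `Fin 4`, acting on the second coordinate. -/
def kleinShift (G : Type) (c : Fin 4) : Equiv.Perm (G × Fin 4) where
  toFun x := (x.1, c ^^^ x.2)
  invFun x := (x.1, c ^^^ x.2)
  left_inv x := by simp [fin_four_xor_xor_self]
  right_inv x := by simp [fin_four_xor_xor_self]

/-- Right multiplication of the first coordinate by the involution indexed by the second one. -/
def twistedMul {G : Type} [Group G] (s : Fin 4 → G) (hs : ∀ i, s i * s i = 1) :
    Equiv.Perm (G × Fin 4) where
  toFun x := (x.1 * s x.2, x.2)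
  invFun x := (x.1 * s x.2, x.2)
  left_inv x := by simp [mul_assoc, hs]
  right_inv x := by simp [mul_assoc, hs]

@[simp] theorem kleinShift_apply {G : Type} (c : Fin 4) (x : G × Fin 4) :
    kleinShift G c x = (x.1, c ^^^ x.2) := rfl

@[simp] theorem twistedMul_apply {G : Type} [Group G] (s : Fin 4 → G) (hs : ∀ i, s i * s i = 1)
    (x : G × Fin 4) : twistedMul s hs x = (x.1 * s x.2, x.2) := rfl

theorem exists_word_of_involutions {G : Type*} [Group G] {ι : Type*} {s : ι → G}
    (hs : ∀ i, s i * s i = 1) (hgen : Subgroup.closure (Set.range s) = ⊤) (g : G) :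
    ∃ w : List ι, (w.map s).prod = g := by
  have hg : g ∈ Subgroup.closure (Set.range s) := hgen ▸ Subgroup.mem_top g
  induction hg using Subgroup.closure_induction_right with
  | one => exact ⟨[], rfl⟩
  | mul_right x _ y hy ih =>
    obtain ⟨w, rfl⟩ := ih
    obtain ⟨i, rfl⟩ := hy
    exact ⟨w ++ [i], by simp⟩
  | mul_inv_cancel x _ y hy ih =>
    obtain ⟨w, rfl⟩ := ih
    obtain ⟨i, rfl⟩ := hy
    refine ⟨w ++ [i], ?_⟩
    rw [inv_eq_of_mul_eq_one_left (hs i)]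
    simp

/-! ### The map of four involutions and its automorphisms -/

namespace SurfaceMap

/-- The map whose flags at one edge are permuted regularly by the Klein four-group `⟨r 0, r 2⟩`, and
whose edges are the elements of the group generated by the four involutions `s i`. -/
def ofInvolutions {G : Type} [Group G] (s : Fin 4 → G) (hs : ∀ i, s i * s i = 1)
    (hgen : Subgroup.closure (Set.range s) = ⊤) : SurfaceMap where
  Flag := G × Fin 4
  nonempty := ⟨(1, 0)⟩
  r := ![kleinShift G 3, twistedMul s hs, kleinShift G 1]
  r_sq i := by
    ext1 x
    fin_cases i <;> simp [fin_four_xor_xor_self, mul_assoc, hs]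
  r_zero_two_sq := by
    ext1 ⟨g, i⟩
    fin_cases i <;> simp
  connected := by
    set r : Fin 3 → Equiv.Perm (G × Fin 4) := ![kleinShift G 3, twistedMul s hs, kleinShift G 1]
    have step : ∀ (i : Fin 3) (x : G × Fin 4),
        x ∈ MulAction.orbit (Subgroup.closure (Set.range r)) ((1, 0) : G × Fin 4) →
        r i x ∈ MulAction.orbit (Subgroup.closure (Set.range r)) ((1, 0) : G × Fin 4) := by
      intro i x hx
      exact MulAction.mem_orbit_of_mem_orbit
        (⟨r i, Subgroup.subset_closure ⟨i, rfl⟩⟩ : Subgroup.closure (Set.range r)) hx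
    -- Within an edge all sheets are reachable, so a word grows by one letter `i` by passing to
    -- sheet `i` and applying `r 1`.
    have key : ∀ w : List (Fin 4), ∀ i : Fin 4, (((w.map s).prod, i) : G × Fin 4) ∈
        MulAction.orbit (Subgroup.closure (Set.range r)) ((1, 0) : G × Fin 4) := by
      intro w
      suffices h : ∃ i : Fin 4, (((w.map s).prod, i) : G × Fin 4) ∈
          MulAction.orbit (Subgroup.closure (Set.range r)) ((1, 0) : G × Fin 4) by
        obtain ⟨i, hi⟩ := h
        exact fun j => klein_induction (P := fun i : Fin 4 => (((w.map s).prod, i) : G × Fin 4) ∈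
          MulAction.orbit (Subgroup.closure (Set.range r)) ((1, 0) : G × Fin 4))
          (fun i h => step 2 _ h) (fun i h => step 0 _ h) hi j
      induction w using List.reverseRecOn with
      | nil => exact ⟨0, MulAction.mem_orbit_self _⟩
      | append_singleton w i ih =>
        obtain ⟨j, hj⟩ := ih
        have hi := klein_induction (P := fun i : Fin 4 => (((w.map s).prod, i) : G × Fin 4) ∈
          MulAction.orbit (Subgroup.closure (Set.range r)) ((1, 0) : G × Fin 4))
          (fun i h => step 2 _ h) (fun i h => step 0 _ h) hj i
        refine ⟨i, ?_⟩
        have := step 1 _ hi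
        simpa [r] using this
    have all : ∀ x : G × Fin 4,
        x ∈ MulAction.orbit (Subgroup.closure (Set.range r)) ((1, 0) : G × Fin 4) := by
      rintro ⟨g, i⟩
      obtain ⟨w, rfl⟩ := exists_word_of_involutions hs hgen g
      exact key w i
    refine ⟨fun x y => ?_⟩
    exact MulAction.mem_orbit_iff.1 (by
      rw [MulAction.orbit_eq_iff.2 (all x)]
      exact all y)

section OfInvolutions

variable {G : Type} [Group G] {s : Fin 4 → G} (hs : ∀ i, s i * s i = 1)
  (hgen : Subgroup.closure (Set.range s) = ⊤)

theorem ofInvolutions_r_one (x : G × Fin 4) :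
    (ofInvolutions s hs hgen).r 1 x = (x.1 * s x.2, x.2) := rfl

theorem mem_aut_iff (M : SurfaceMap) (f : Equiv.Perm M.Flag) :
    f ∈ M.Aut ↔ ∀ i φ, f (M.r i φ) = M.r i (f φ) := by
  constructor
  · intro hf i φ
    exact (DFunLike.congr_fun
      (Subgroup.mem_centralizer_iff.1 hf _ (Subgroup.subset_closure ⟨i, rfl⟩)) φ).symm
  · intro h
    have : M.Mon ≤ Subgroup.centralizer {f} := by
      refine (Subgroup.closure_le _).2 ?_
      rintro _ ⟨i, rfl⟩
      refine Subgroup.mem_centralizer_iff.2 ?_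
      rintro _ rfl
      exact Equiv.ext fun φ => h i φ
    refine Subgroup.mem_centralizer_iff.2 fun g hg => ?_
    exact (Subgroup.mem_centralizer_iff.1 (this hg) f rfl).symm

/-- Left multiplication by a group element, as an automorphism. -/
def ofInvolutionsLeft : G →* (ofInvolutions s hs hgen).Aut where
  toFun g := ⟨((Equiv.mulLeft g).prodCongr (Equiv.refl (Fin 4)) : Equiv.Perm (G × Fin 4)), by
    refine (mem_aut_iff (ofInvolutions s hs hgen) _).2 ?_
    intro i x
    fin_cases i
    · rfl
    · exact Prod.ext (mul_assoc g x.1 (s x.2)).symm rfl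
    · rfl⟩
  map_one' := Subtype.ext <| Equiv.ext fun x => Prod.ext (one_mul x.1) rfl
  map_mul' g h := Subtype.ext <| Equiv.ext fun x => Prod.ext (mul_assoc g h x.1) rfl

theorem ofInvolutionsLeft_apply (g : G) (x : G × Fin 4) :
    (ofInvolutionsLeft hs hgen g : Equiv.Perm (ofInvolutions s hs hgen).Flag) x =
      (g * x.1, x.2) := rfl

/-- By connectedness an automorphism is determined by its value `(g₀, j)` at the base flag.
Commuting with `r 0` and `r 2` forces it to translate sheets by `j`, so transporting it along a word
replaces each letter `i` by `j ^^^ i`. -/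
theorem aut_ofInvolutions_apply (f : (ofInvolutions s hs hgen).Aut) (g₀ : G) (j : Fin 4)
    (h : (f : Equiv.Perm (ofInvolutions s hs hgen).Flag) ((1, 0) : G × Fin 4) =
      ((g₀, j) : G × Fin 4)) (w : List (Fin 4)) (i : Fin 4) :
    (f : Equiv.Perm (ofInvolutions s hs hgen).Flag) (((w.map s).prod, i) : G × Fin 4) =
      ((g₀ * (w.map fun i => s (j ^^^ i)).prod, j ^^^ i) : G × Fin 4) := by
  have hf := (mem_aut_iff _ _).1 f.2
  set F : G × Fin 4 → G × Fin 4 := ⇑(f : Equiv.Perm (ofInvolutions s hs hgen).Flag) with hF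
  have h0 : ∀ x : G × Fin 4, F (x.1, 3 ^^^ x.2) = ((F x).1, 3 ^^^ (F x).2) := hf 0
  have h1 : ∀ x : G × Fin 4, F (x.1 * s x.2, x.2) = ((F x).1 * s (F x).2, (F x).2) := hf 1
  have h2 : ∀ x : G × Fin 4, F (x.1, 1 ^^^ x.2) = ((F x).1, 1 ^^^ (F x).2) := hf 2
  have spread : ∀ (g g' : G) (c c' : Fin 4), F (g, c) = (g', c') →
      ∀ i, F (g, i) = (g', c' ^^^ c ^^^ i) := by
    intro g g' c c' hc i
    refine klein_induction (P := fun i => F (g, i) = (g', c' ^^^ c ^^^ i)) (fun i hi => ?_)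
      (fun i hi => ?_) (i := c) ?_ i
    · rw [h2 (g, i), hi]
      refine Prod.ext rfl ?_
      change 1 ^^^ (c' ^^^ c ^^^ i) = c' ^^^ c ^^^ (1 ^^^ i)
      clear hc hi h0 h1 h2 h hf
      revert c c' i; decide
    · rw [h0 (g, i), hi]
      refine Prod.ext rfl ?_
      change 3 ^^^ (c' ^^^ c ^^^ i) = c' ^^^ c ^^^ (3 ^^^ i)
      clear hc hi h0 h1 h2 h hf
      revert c c' i; decide
    · rw [hc, show c' ^^^ c ^^^ c = c' by clear hc h; revert c c'; decide]
  suffices hw : F ((w.map s).prod, 0) = (g₀ * (w.map fun i => s (j ^^^ i)).prod, j) by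
    have := spread _ _ _ _ hw i
    rwa [fin_four_xor_zero] at this
  induction w using List.reverseRecOn with
  | nil => exact h.trans (Prod.ext (mul_one g₀).symm rfl)
  | append_singleton w k ih =>
    -- Move to sheet `k`, cross by `r 1`, and return to sheet 0.
    have e := spread _ _ _ _ ih k
    rw [fin_four_xor_zero] at e
    have e' := h1 ((w.map s).prod, k)
    rw [e] at e'
    have e'' := spread _ _ _ _ e' 0
    simp only [List.map_append, List.prod_append, List.map_cons, List.map_nil, List.prod_cons,
      List.prod_nil, mul_one, ← mul_assoc]
    rw [e'']
    refine Prod.ext rfl ?_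
    change j ^^^ k ^^^ k ^^^ 0 = j
    clear h ih e e' e''
    revert j k; decide

/-- No non-trivial element of the Klein four-group permuting the four generators extends to the
group they generate, as witnessed by relations. -/
def KleinRigid (s : Fin 4 → G) : Prop :=
  ∀ j : Fin 4, j ≠ 0 → ∃ w : List (Fin 4),
    (w.map s).prod = 1 ∧ (w.map fun i => s (j ^^^ i)).prod ≠ 1

/-- If `j ≠ 0`, a rigidity relation `w` gives two names, `w` and the empty word, for the base flag,
and the preceding formula assigns them different images. -/
theorem ofInvolutionsLeft_surjective (hrig : KleinRigid s) :
    Function.Surjective (ofInvolutionsLeft hs hgen) := by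
  intro f
  obtain ⟨⟨g₀, j⟩, h⟩ : ∃ x : G × Fin 4,
    (f : Equiv.Perm (ofInvolutions s hs hgen).Flag) ((1, 0) : G × Fin 4) = x := ⟨_, rfl⟩
  have key := aut_ofInvolutions_apply hs hgen f g₀ j h
  obtain rfl : j = 0 := by
    by_contra hj
    obtain ⟨w, hw, hw'⟩ := hrig j hj
    have e := key w 0
    have e' := key [] 0
    rw [hw] at e
    simp only [List.map_nil, List.prod_nil] at e'
    rw [e] at e'
    exact hw' (mul_left_cancel (congrArg Prod.fst e'))
  refine ⟨g₀, Subtype.ext <| Equiv.ext ?_⟩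
  rintro ⟨g, i⟩
  obtain ⟨w, rfl⟩ := exists_word_of_involutions hs hgen g
  rw [key, ofInvolutionsLeft_apply]
  have hx : ∀ i : Fin 4, (0 : Fin 4) ^^^ i = i := by decide
  simp only [hx]
  rfl

end OfInvolutions

end SurfaceMap

/-! ### Cells, orientability and reflections of the map -/

namespace SurfaceMap

theorem cell_r (M : SurfaceMap) {i j : Fin 3} (hj : j ≠ i) (φ : M.Flag) :
    M.cell i (M.r j φ) = M.cell i φ :=
  Quotient.sound ⟨⟨M.r j, Subgroup.subset_closure ⟨j, hj, rfl⟩⟩, rfl⟩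

/-- Used to tell cells apart: a property of flags preserved by the two generators that fix a cell is
a property of the cell. -/
theorem iff_of_cell_eq (M : SurfaceMap) {i : Fin 3} {P : M.Flag → Prop}
    (hP : ∀ j, j ≠ i → ∀ φ, P (M.r j φ) ↔ P φ) {φ ψ : M.Flag} (h : M.cell i φ = M.cell i ψ) :
    P φ ↔ P ψ := by
  obtain ⟨⟨g, hg⟩, rfl⟩ := Quotient.exact h
  change P (g ψ) ↔ P ψ
  clear h
  induction hg using Subgroup.closure_induction generalizing ψ with
  | mem x hx =>
    obtain ⟨j, hj, rfl⟩ := hx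
    exact hP j hj ψ
  | one => rfl
  | mul x y _ _ hx hy =>
    rw [Equiv.Perm.mul_apply, hx, hy]
  | inv x _ hx =>
    rw [← hx (ψ := x⁻¹ ψ), show x (x⁻¹ ψ) = ψ from x.apply_symm_apply ψ]

section OfInvolutions

variable {G : Type} [Group G] {s : Fin 4 → G} (hs : ∀ i, s i * s i = 1)
  (hgen : Subgroup.closure (Set.range s) = ⊤)

theorem ofInvolutions_isCompact [Finite G] : (ofInvolutions s hs hgen).IsCompact :=
  inferInstanceAs (Finite (G × Fin 4))

theorem ofInvolutions_not_hasBoundary (hs' : ∀ i, s i ≠ 1) :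
    ¬ (ofInvolutions s hs hgen).HasBoundary := by
  have h3 : ∀ i : Fin 4, 3 ^^^ i ≠ i := by decide
  have h1 : ∀ i : Fin 4, 1 ^^^ i ≠ i := by decide
  rintro ⟨i, x, hx⟩
  fin_cases i
  · exact h3 _ (congrArg Prod.snd hx)
  · exact hs' _ (mul_eq_left.1 (congrArg Prod.fst hx))
  · exact h1 _ (congrArg Prod.snd hx)

theorem ofInvolutions_orientable_iff (hs' : ∀ i, s i ≠ 1) :
    (ofInvolutions s hs hgen).Orientable ↔ ∃ χ : G → Bool, ∀ g i, χ (g * s i) ≠ χ g := by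
  have hb := ofInvolutions_not_hasBoundary hs hgen hs'
  constructor
  · rintro ⟨c, hc⟩
    have hc' : ∀ i x, c ((ofInvolutions s hs hgen).r i x) = !(c x) :=
      fun i x => Bool.eq_not_of_ne (hc i x fun h => hb ⟨i, x, h⟩)
    have h0 : ∀ (g : G) (i : Fin 4), c ((g, 3 ^^^ i) : G × Fin 4) = !(c ((g, i) : G × Fin 4)) :=
      fun g i => hc' 0 ((g, i) : G × Fin 4)
    have h1 : ∀ (g : G) (i : Fin 4), c ((g * s i, i) : G × Fin 4) = !(c ((g, i) : G × Fin 4)) :=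
      fun g i => hc' 1 ((g, i) : G × Fin 4)
    have h2 : ∀ (g : G) (i : Fin 4), c ((g, 1 ^^^ i) : G × Fin 4) = !(c ((g, i) : G × Fin 4)) :=
      fun g i => hc' 2 ((g, i) : G × Fin 4)
    -- The colours on sheet `i` differ from those on sheet 0 by a constant, so the colouring of
    -- flags descends to `G`.
    have flip : ∀ i : Fin 4, ∃ b : Bool, ∀ g : G,
        c ((g, i) : G × Fin 4) = (b ^^ c ((g, 0) : G × Fin 4)) := by
      refine klein_induction (i := 0) ?_ ?_ ⟨false, fun g => by simp⟩
      · rintro i ⟨b, hb⟩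
        exact ⟨!b, fun g => by rw [h2, hb]; simp⟩
      · rintro i ⟨b, hb⟩
        exact ⟨!b, fun g => by rw [h0, hb]; simp⟩
    refine ⟨fun g => c ((g, 0) : G × Fin 4), fun g i => ?_⟩
    obtain ⟨b, hb⟩ := flip i
    have := h1 g i
    rw [hb, hb] at this
    change c ((g * s i, 0) : G × Fin 4) ≠ c ((g, 0) : G × Fin 4)
    generalize c ((g * s i, 0) : G × Fin 4) = p at this ⊢
    generalize c ((g, 0) : G × Fin 4) = q at this ⊢
    clear hb
    revert b p q
    decide
  · rintro ⟨χ, hχ⟩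
    have h3 : ∀ i : Fin 4, decide ((3 ^^^ i).val % 2 = 1) = !(decide (i.val % 2 = 1)) := by decide
    have h1 : ∀ i : Fin 4, decide ((1 ^^^ i).val % 2 = 1) = !(decide (i.val % 2 = 1)) := by decide
    -- Both translations, by 1 and by 3, change the parity of the sheet.
    refine ⟨fun x : G × Fin 4 => (χ x.1 ^^ decide (x.2.val % 2 = 1)), fun i x _ => ?_⟩
    obtain ⟨g, j⟩ : G × Fin 4 := x
    have hg := Bool.eq_not_of_ne (hχ g j)
    fin_cases i
    · change (χ g ^^ decide ((3 ^^^ j).val % 2 = 1)) ≠ (χ g ^^ decide (j.val % 2 = 1))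
      rw [h3]; simp
    · change (χ (g * s j) ^^ decide (j.val % 2 = 1)) ≠ (χ g ^^ decide (j.val % 2 = 1))
      rw [hg]; simp
    · change (χ g ^^ decide ((1 ^^^ j).val % 2 = 1)) ≠ (χ g ^^ decide (j.val % 2 = 1))
      rw [h1]; simp

theorem ofInvolutionsLeft_injective : Function.Injective (ofInvolutionsLeft hs hgen) := by
  intro g h e
  have : ((g * 1, 0) : G × Fin 4) = (h * 1, 0) := by
    rw [← ofInvolutionsLeft_apply hs hgen g (1, 0), ← ofInvolutionsLeft_apply hs hgen h (1, 0), e]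
  simpa using congrArg Prod.fst this

theorem ofInvolutionsLeft_edgeFlags (i : Fin 4) :
    (ofInvolutionsLeft hs hgen (s i) : Equiv.Perm (ofInvolutions s hs hgen).Flag)
        ((ofInvolutions s hs hgen).edgeFlags ((1, 0) : G × Fin 4) i) =
      (ofInvolutions s hs hgen).r 1
        ((ofInvolutions s hs hgen).edgeFlags ((1, 0) : G × Fin 4) i) := by
  have : (ofInvolutions s hs hgen).edgeFlags ((1, 0) : G × Fin 4) i = ((1, i) : G × Fin 4) := by
    fin_cases i
    exacts [rfl, rfl, Prod.ext rfl (show (1 : Fin 4) ^^^ (3 ^^^ 0) = 2 by decide), rfl]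
  rw [this, ofInvolutionsLeft_apply, ofInvolutions_r_one]
  simp only [mul_one, one_mul]
  rfl

/-- Left multiplication keeps the sheet while `r 0` and `r 2` change it, so only `r 1` can occur;
there the condition reads `g * h = h * s j`. -/
theorem ofInvolutionsLeft_isReflection_iff (hs' : ∀ i, s i ≠ 1) (g : G) :
    (ofInvolutions s hs hgen).IsReflection (ofInvolutionsLeft hs hgen g) ↔
      ∃ i, IsConj (s i) g := by
  have h3 : ∀ i : Fin 4, 3 ^^^ i ≠ i := by decide
  have h1 : ∀ i : Fin 4, 1 ^^^ i ≠ i := by decide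
  constructor
  · rintro ⟨-, i, x, hx⟩
    obtain ⟨h, j⟩ : G × Fin 4 := x
    fin_cases i
    · exact absurd (congrArg Prod.snd hx).symm (h3 _)
    · have : g * h = h * s j := congrArg Prod.fst hx
      exact ⟨j, isConj_iff.2 ⟨h, by rw [← this]; group⟩⟩
    · exact absurd (congrArg Prod.snd hx).symm (h1 _)
  · rintro ⟨i, hi⟩
    obtain ⟨h, rfl⟩ := isConj_iff.1 hi
    refine ⟨fun e => hs' i ?_, 1, ((h, i) : G × Fin 4), ?_⟩
    · have := ofInvolutionsLeft_injective hs hgen (e.trans (map_one _).symm)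
      simpa using this
    · rw [ofInvolutionsLeft_apply, ofInvolutions_r_one]
      simp only [inv_mul_cancel_right]
      rfl

theorem ofInvolutions_justEdgeTransitive (hrig : KleinRigid s) :
    (ofInvolutions s hs hgen).JustEdgeTransitive := by
  have hsurj := ofInvolutionsLeft_surjective hs hgen hrig
  refine ⟨⟨fun x y => ?_⟩, fun ⟨h⟩ => ?_, fun ⟨h⟩ => ?_⟩
  · have all : ∀ (g : G) (i : Fin 4), (ofInvolutions s hs hgen).cell 1 ((g, i) : G × Fin 4) =
        (ofInvolutions s hs hgen).cell 1 ((g, 0) : G × Fin 4) := by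
      intro g
      refine klein_induction (i := 0) (fun i hi => ?_) (fun i hi => ?_) rfl
      · exact (cell_r (ofInvolutions s hs hgen) (i := 1) (j := 2) (by decide) ((g, i) : G × Fin 4)).trans hi
      · exact (cell_r (ofInvolutions s hs hgen) (i := 1) (j := 0) (by decide) ((g, i) : G × Fin 4)).trans hi
    induction x using Quotient.inductionOn with
    | _ x =>
    induction y using Quotient.inductionOn with
    | _ y =>
    obtain ⟨g, i⟩ : G × Fin 4 := x
    obtain ⟨h, j⟩ : G × Fin 4 := y
    refine ⟨ofInvolutionsLeft hs hgen (h * g⁻¹), ?_⟩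
    refine ((all (h * g⁻¹ * g) i).trans ?_).trans (all h j).symm
    simp
  · obtain ⟨a, ha⟩ := h ((ofInvolutions s hs hgen).cell 0 ((1, 0) : G × Fin 4))
      ((ofInvolutions s hs hgen).cell 0 ((1, 3) : G × Fin 4))
    obtain ⟨g, rfl⟩ := hsurj a
    -- Around a vertex only `r 1` and `r 2` act, and they preserve the pair of sheets `{0, 1}`.
    have key := iff_of_cell_eq _ (P := fun x : G × Fin 4 => x.2.val < 2) (fun j hj x => ?_) ha
    · exact absurd (key.1 (show (0 : Fin 4).val < 2 by decide)) (show ¬ (3 : Fin 4).val < 2 by decide)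
    · have h1 : ∀ i : Fin 4, (1 ^^^ i).val < 2 ↔ i.val < 2 := by decide
      fin_cases j
      · exact absurd rfl hj
      · exact Iff.rfl
      · exact h1 _
  · obtain ⟨a, ha⟩ := h ((ofInvolutions s hs hgen).cell 2 ((1, 0) : G × Fin 4))
      ((ofInvolutions s hs hgen).cell 2 ((1, 1) : G × Fin 4))
    obtain ⟨g, rfl⟩ := hsurj a
    -- Around a face only `r 0` and `r 1` act, and they preserve the pair of sheets `{0, 3}`.
    have key := iff_of_cell_eq _ (P := fun x : G × Fin 4 => x.2.val % 3 = 0) (fun j hj x => ?_) ha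
    · exact absurd (key.1 (show (0 : Fin 4).val % 3 = 0 by decide))
        (show ¬ (1 : Fin 4).val % 3 = 0 by decide)
    · have h3 : ∀ i : Fin 4, (3 ^^^ i).val % 3 = 0 ↔ i.val % 3 = 0 := by decide
      fin_cases j
      · exact h3 _
      · exact Iff.rfl
      · exact absurd rfl hj

/-- The automorphism group of the map is the group generated by the four involutions. -/
noncomputable def ofInvolutionsAutEquiv (hrig : KleinRigid s) :
    G ≃* (ofInvolutions s hs hgen).Aut :=
  MulEquiv.ofBijective (ofInvolutionsLeft hs hgen)
    ⟨ofInvolutionsLeft_injective hs hgen, ofInvolutionsLeft_surjective hs hgen hrig⟩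

theorem ofInvolutions_cr (hrig : KleinRigid s) (hs' : ∀ i, s i ≠ 1) :
    (ofInvolutions s hs hgen).cr = (Set.range fun i => ConjClasses.mk (s i)).ncard := by
  have hinj : Function.Injective (ConjClasses.map (ofInvolutionsLeft hs hgen)) := by
    intro x y
    induction x using Quotient.inductionOn with
    | _ x =>
    induction y using Quotient.inductionOn with
    | _ y =>
    intro h
    have h' := ConjClasses.mk_eq_mk_iff_isConj.1 h
    refine ConjClasses.mk_eq_mk_iff_isConj.2 ?_
    have := (ofInvolutionsAutEquiv hs hgen hrig).symm.toMonoidHom.map_isConj h'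
    have e : ∀ g, (ofInvolutionsAutEquiv hs hgen hrig).symm (ofInvolutionsLeft hs hgen g) = g :=
      (ofInvolutionsAutEquiv hs hgen hrig).symm_apply_apply
    simpa [e] using this
  rw [cr, ← Set.ncard_image_of_injective _ hinj]
  congr 1
  ext C
  constructor
  · rintro ⟨a, ha, rfl⟩
    obtain ⟨g, rfl⟩ := ofInvolutionsLeft_surjective hs hgen hrig a
    obtain ⟨i, hi⟩ := (ofInvolutionsLeft_isReflection_iff hs hgen hs' g).1 ha
    exact ⟨_, ⟨i, rfl⟩, congrArg (ConjClasses.map (ofInvolutionsLeft hs hgen))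
      (ConjClasses.mk_eq_mk_iff_isConj.2 hi)⟩
  · rintro ⟨_, ⟨i, rfl⟩, rfl⟩
    exact ⟨_, (ofInvolutionsLeft_isReflection_iff hs hgen hs' (s i)).2 ⟨i, IsConj.refl _⟩, rfl⟩

theorem closure_range_ofInvolutionsLeft (hrig : KleinRigid s) :
    Subgroup.closure (Set.range fun i => ofInvolutionsLeft hs hgen (s i)) = ⊤ := by
  have : (Set.range fun i => ofInvolutionsLeft hs hgen (s i)) =
      ofInvolutionsLeft hs hgen '' Set.range s := by
    rw [← Set.range_comp]; rfl
  rw [this, ← MonoidHom.map_closure, hgen,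
    Subgroup.map_top_of_surjective _ (ofInvolutionsLeft_surjective hs hgen hrig)]

end OfInvolutions

end SurfaceMap

/-! ### Involutions defined by matchings in a path -/

/-- The product of the transpositions `(j, j + 1)` of `{0, …, N}` over the `j` satisfying `E`. -/
def matchingPerm (N : ℕ) (E : ℕ → Prop) [DecidablePred E] : Equiv.Perm (Fin (N + 1)) :=
  ((List.finRange N).map fun j : Fin N =>
    if E j then Equiv.swap j.castSucc j.succ else 1).prod

section Matching

variable {N : ℕ} {E : ℕ → Prop} [DecidablePred E]

theorem matchingPerm_congr {E' : ℕ → Prop} [DecidablePred E'] (h : ∀ j < N, (E j ↔ E' j)) :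
    matchingPerm N E = matchingPerm N E' := by
  unfold matchingPerm
  congr 1
  refine List.map_congr_left fun j _ => ?_
  simp only [h j j.2]

/-- Edges of a path share a vertex only when consecutive, and consecutive edges are not both
selected. -/
theorem pairwise_disjoint_matching (hE : ∀ j, j + 1 < N → E j → ¬ E (j + 1)) :
    ((List.finRange N).map fun j : Fin N =>
      if E j then Equiv.swap j.castSucc j.succ else 1).Pairwise Equiv.Perm.Disjoint := by
  rw [List.pairwise_map]
  refine (List.pairwise_lt_finRange N).imp fun {i j} hij => ?_
  by_cases hi : E i
  swap
  · simp only [hi, if_false]; exact Equiv.Perm.disjoint_one_left _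
  by_cases hj : E j
  swap
  · simp only [hj, if_false]; exact Equiv.Perm.disjoint_one_right _
  have hne : (i : ℕ) + 1 ≠ j := by
    intro h
    exact hE i (h ▸ j.2) hi (h ▸ hj)
  have hlt : (i : ℕ) < j := hij
  simp only [hi, hj, if_true]
  intro q
  by_cases hq : q = i.castSucc ∨ q = i.succ
  · right
    refine Equiv.swap_apply_of_ne_of_ne ?_ ?_ <;> rintro rfl <;>
      simp only [Fin.ext_iff, Fin.val_castSucc, Fin.val_succ] at hq <;> omega
  · left
    rw [not_or] at hq
    exact Equiv.swap_apply_of_ne_of_ne hq.1 hq.2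

theorem matchingPerm_apply_of_edge (hE : ∀ j, j + 1 < N → E j → ¬ E (j + 1)) (j : Fin N)
    (hj : E j) (q : Fin (N + 1)) (hq : q = j.castSucc ∨ q = j.succ) :
    matchingPerm N E q = Equiv.swap j.castSucc j.succ q := by
  refine (Equiv.Perm.eq_on_support_mem_disjoint
    (List.mem_map.2 ⟨j, List.mem_finRange j, if_pos hj⟩) (pairwise_disjoint_matching hE) q ?_).symm
  rw [Equiv.Perm.support_swap (by simp [Fin.ext_iff])]
  simpa using hq

theorem matchingPerm_apply_val (hE : ∀ j, j + 1 < N → E j → ¬ E (j + 1)) (q : Fin (N + 1)) :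
    (matchingPerm N E q : ℕ) = if (q : ℕ) < N ∧ E q then (q : ℕ) + 1 else
      if 0 < (q : ℕ) ∧ E (q - 1) then (q : ℕ) - 1 else q := by
  split_ifs with h1 h2
  · obtain ⟨j, rfl⟩ : ∃ j : Fin N, q = j.castSucc := ⟨⟨q, h1.1⟩, rfl⟩
    rw [matchingPerm_apply_of_edge hE j h1.2 _ (Or.inl rfl), Equiv.swap_apply_left]
    rfl
  · obtain ⟨j, rfl⟩ : ∃ j : Fin N, q = j.succ :=
      ⟨⟨q - 1, by omega⟩, Fin.ext (by simp only [Fin.succ_mk]; omega)⟩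
    rw [matchingPerm_apply_of_edge hE j h2.2 _ (Or.inr rfl), Equiv.swap_apply_right]
    rfl
  · have hfix : matchingPerm N E ∈ MulAction.stabilizer (Equiv.Perm (Fin (N + 1))) q := by
      refine Subgroup.list_prod_mem _ fun σ hσ => ?_
      obtain ⟨j, -, rfl⟩ := List.mem_map.1 hσ
      rw [MulAction.mem_stabilizer_iff]
      change (if E j then Equiv.swap j.castSucc j.succ else 1) q = q
      split_ifs with hj
      · refine Equiv.swap_apply_of_ne_of_ne ?_ ?_
        · rintro rfl
          exact h1 ⟨j.2, hj⟩
        · rintro rfl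
          exact h2 ⟨Nat.succ_pos _, hj⟩
      · rfl
    exact congrArg Fin.val hfix

theorem Equiv.Perm.cycleType_list_prod_of_disjoint {α : Type*} [Fintype α] [DecidableEq α]
    {l : List (Equiv.Perm α)} (h : l.Pairwise Equiv.Perm.Disjoint) :
    l.prod.cycleType = (l.map Equiv.Perm.cycleType).sum := by
  induction l with
  | nil => simp
  | cons σ l ih =>
    rw [List.pairwise_cons] at h
    rw [List.prod_cons, (Equiv.Perm.disjoint_prod_right l h.1).cycleType_mul, ih h.2]
    simp

theorem matchingPerm_cycleType (hE : ∀ j, j + 1 < N → E j → ¬ E (j + 1)) :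
    (matchingPerm N E).cycleType =
      Multiset.replicate (∑ j ∈ Finset.range N, if E j then 1 else 0) 2 := by
  rw [matchingPerm, Equiv.Perm.cycleType_list_prod_of_disjoint (pairwise_disjoint_matching hE),
    List.map_map]
  have : (Equiv.Perm.cycleType ∘ fun j : Fin N =>
      if E j then Equiv.swap j.castSucc j.succ else 1) =
      fun j : Fin N => if E j then ({2} : Multiset ℕ) else 0 := by
    funext j
    simp only [Function.comp_apply]
    split_ifs
    · have hne : j.castSucc ≠ j.succ := by simp [Fin.ext_iff]
      rw [(Equiv.Perm.isCycle_swap hne).cycleType, Equiv.Perm.card_support_swap hne]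
    · exact Equiv.Perm.cycleType_one
  rw [this, ← List.ofFn_eq_map, List.sum_ofFn,
    Fin.sum_univ_eq_sum_range (fun j => if E j then ({2} : Multiset ℕ) else 0)]
  have : ∀ n, ∑ j ∈ Finset.range n, (if E j then ({2} : Multiset ℕ) else 0) =
      Multiset.replicate (∑ j ∈ Finset.range n, if E j then 1 else 0) 2 := by
    intro n
    induction n with
    | zero => simp
    | succ n ih =>
      rw [Finset.sum_range_succ, Finset.sum_range_succ, ih, Multiset.replicate_add]
      split_ifs <;> simp
  exact this N

end Matching

/-! ### The two label patterns -/

/-- A labelling of the `2a + 2b + 4` edges of a path: `2`, then `x`, then `a` times `2, 3`,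
then `0` alternating with `1`, and finally `y`. -/
def patternLabel (a b : ℕ) (x y : Fin 4) (j : ℕ) : Fin 4 :=
  if j = 0 then 2
  else if j = 1 then x
  else if j < 2 * a + 2 then (if j % 2 = 0 then 2 else 3)
  else if j < 2 * a + 2 * b + 3 then (if j % 2 = 0 then 0 else 1)
  else y

theorem pathPerm_eq_matchingPerm (k m : ℕ) (i : Fin 4) :
    pathPerm k m i = matchingPerm (4 * m) fun j => pathLabel k m (j + 1) = i := rfl

theorem pathLabel_eq_patternLabel {k m a b : ℕ} {x y : Fin 4} (hm : 4 * m = 2 * a + 2 * b + 4)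
    (hl : pathParts k m 2 + pathParts k m 3 = 2 * a + 2)
    (hx : (if pathParts k m 0 = pathParts k m 1 + 2 then 0 else 1) = x)
    (hy : (if pathParts k m 2 = pathParts k m 3 + 2 then 2 else 3) = y) {j : ℕ}
    (hj : j < 4 * m) : pathLabel k m (j + 1) = patternLabel a b x y j := by
  simp only [pathLabel, patternLabel, hx, hy, hl, Nat.even_iff]
  by_cases h0 : j = 0
  · simp [h0]
  by_cases h1 : j = 1
  · simp [h1]
  rw [if_neg (by omega), if_neg (by omega), if_neg h0, if_neg h1]
  by_cases h2 : j < 2 * a + 2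
  · rw [if_pos (by omega), if_pos h2]
    exact if_congr (by omega) rfl rfl
  rw [if_neg (by omega), if_neg h2]
  by_cases h3 : j < 2 * a + 2 * b + 3
  · rw [if_pos (by omega), if_pos h3]
    exact if_congr (by omega) rfl rfl
  rw [if_neg (by omega), if_neg h3]

/-- The labels depend on `k` only through `m₃ + m₄ = 2a + 2` and through whether the parts agree in
pairs or differ by two, so two patterns cover all four values. The bound `1 ≤ a` comes from `m ≥ 3`,
except for `k = 4`, where `a = m - 3` is the last part. -/
theorem exists_pattern {k m : ℕ} (hk : k ∈ Finset.Icc 1 4) (hm : PathAdmissible k m) :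
    ∃ (a b : ℕ), 1 ≤ a ∧ 1 ≤ b ∧ 4 * m = 2 * a + 2 * b + 4 ∧
      (((∀ j < 4 * m, pathLabel k m (j + 1) = patternLabel a b 1 3 j) ∧
        pathParts k m = ![b + 1, b + 1, a + 1, a + 1]) ∨
       ((∀ j < 4 * m, pathLabel k m (j + 1) = patternLabel a b 0 2 j) ∧
        pathParts k m = ![b + 2, b, a + 2, a])) := by
  obtain ⟨h3, -, hpos⟩ := hm
  have hlast := hpos 3
  rw [Finset.mem_Icc] at hk
  obtain ⟨hk1, hk4⟩ := hk
  have hA : ∀ a b : ℕ, 4 * m = 2 * a + 2 * b + 4 →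
      pathParts k m = ![b + 1, b + 1, a + 1, a + 1] →
      ∀ j < 4 * m, pathLabel k m (j + 1) = patternLabel a b 1 3 j := by
    intro a b hm hp j hj
    refine pathLabel_eq_patternLabel hm ?_ (by simp [hp]) (by simp [hp]) hj
    simp only [hp, Matrix.cons_val]
    omega
  have hB : ∀ a b : ℕ, 4 * m = 2 * a + 2 * b + 4 →
      pathParts k m = ![b + 2, b, a + 2, a] →
      ∀ j < 4 * m, pathLabel k m (j + 1) = patternLabel a b 0 2 j := by
    intro a b hm hp j hj
    refine pathLabel_eq_patternLabel hm ?_ (by simp [hp]) (by simp [hp]) hj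
    simp only [hp, Matrix.cons_val]
    omega
  have ext4 : ∀ u v : Fin 4 → ℕ, u 0 = v 0 → u 1 = v 1 → u 2 = v 2 → u 3 = v 3 → u = v := by
    intro u v h0 h1 h2 h3
    ext i
    fin_cases i <;> assumption
  interval_cases k
  · have hp : pathParts 1 m = ![m - 1 + 1, m - 1 + 1, m - 1 + 1, m - 1 + 1] := by
      apply ext4 <;> simp [pathParts] <;> omega
    have hab : 4 * m = 2 * (m - 1) + 2 * (m - 1) + 4 := by omega
    exact ⟨m - 1, m - 1, by omega, by omega, hab, Or.inl ⟨hA _ _ hab hp, hp⟩⟩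
  · have hp : pathParts 2 m = ![m + 1, m + 1, m - 2 + 1, m - 2 + 1] := by
      apply ext4 <;> simp [pathParts] <;> omega
    have hab : 4 * m = 2 * (m - 2) + 2 * m + 4 := by omega
    exact ⟨m - 2, m, by omega, by omega, hab, Or.inl ⟨hA _ _ hab hp, hp⟩⟩
  · have hp : pathParts 3 m = ![m + 2, m, m - 2 + 2, m - 2] := by
      apply ext4 <;> simp [pathParts] <;> omega
    have hab : 4 * m = 2 * (m - 2) + 2 * m + 4 := by omega
    exact ⟨m - 2, m, by omega, by omega, hab, Or.inr ⟨hB _ _ hab hp, hp⟩⟩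
  · replace hlast : 0 < m - 3 := hlast
    have hp : pathParts 4 m = ![m + 1 + 2, m + 1, m - 3 + 2, m - 3] := by
      apply ext4 <;> simp [pathParts] <;> omega
    have hab : 4 * m = 2 * (m - 3) + 2 * (m + 1) + 4 := by omega
    exact ⟨m - 3, m + 1, by omega, by omega, hab, Or.inr ⟨hB _ _ hab hp, hp⟩⟩

theorem sum_range_two_mul_alternating (f : ℕ → ℕ) (n : ℕ) (u v : ℕ)
    (h0 : ∀ j < n, f (2 * j) = u) (h1 : ∀ j < n, f (2 * j + 1) = v) :
    ∑ j ∈ Finset.range (2 * n), f j = n * (u + v) := by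
  induction n with
  | zero => simp
  | succ n ih =>
    rw [show 2 * (n + 1) = 2 * n + 1 + 1 by ring, Finset.sum_range_succ, Finset.sum_range_succ,
      ih (fun j hj => h0 j (by omega)) (fun j hj => h1 j (by omega)), h0 n (by omega),
      h1 n (by omega)]
    ring

theorem sum_patternLabel (a b : ℕ) (x y i : Fin 4) :
    (∑ j ∈ Finset.range (2 * a + 2 * b + 4), if patternLabel a b x y j = i then 1 else 0) =
      (if 2 = i then 1 else 0) + (if x = i then 1 else 0) +
      a * ((if 2 = i then 1 else 0) + (if 3 = i then 1 else 0)) +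
      (b * ((if 0 = i then 1 else 0) + (if 1 = i then 1 else 0)) +
      (if 0 = i then 1 else 0) + (if y = i then 1 else 0)) := by
  have val : ∀ {j : ℕ} {v : Fin 4}, patternLabel a b x y j = v →
      (if patternLabel a b x y j = i then 1 else 0) = if v = i then 1 else 0 := by
    rintro j v rfl; rfl
  rw [show 2 * a + 2 * b + 4 = 1 + 1 + 2 * a + (2 * b + 1 + 1) by ring, Finset.sum_range_add,
    Finset.sum_range_add, Finset.sum_range_succ (n := 2 * b + 1),
    Finset.sum_range_succ (n := 2 * b), Finset.sum_range_succ (n := 1), Finset.sum_range_one,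
    sum_range_two_mul_alternating _ a (if 2 = i then 1 else 0) (if 3 = i then 1 else 0),
    sum_range_two_mul_alternating _ b (if 0 = i then 1 else 0) (if 1 = i then 1 else 0)]
  · refine congrArg₂ HAdd.hAdd rfl
      (congrArg₂ HAdd.hAdd (congrArg₂ HAdd.hAdd rfl (val ?_)) (val ?_))
    · rw [patternLabel, if_neg (by omega), if_neg (by omega), if_neg (by omega),
        if_pos (by omega), if_pos (by omega)]
    · rw [patternLabel, if_neg (by omega), if_neg (by omega), if_neg (by omega),
        if_neg (by omega)]
  all_goals
    intro j hj
    refine val ?_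
    rw [patternLabel]
  · rw [if_neg (by omega), if_neg (by omega), if_neg (by omega), if_pos (by omega),
      if_pos (by omega)]
  · rw [if_neg (by omega), if_neg (by omega), if_neg (by omega), if_pos (by omega),
      if_neg (by omega)]
  · rw [if_neg (by omega), if_neg (by omega), if_pos (by omega), if_pos (by omega)]
  · rw [if_neg (by omega), if_neg (by omega), if_pos (by omega), if_neg (by omega)]

/-- The permutation of `{0, …, N}` given by the edges with label `i` in the pattern. -/
def patternPerm (N a b : ℕ) (x y i : Fin 4) : Equiv.Perm (Fin (N + 1)) :=
  matchingPerm N fun j => patternLabel a b x y j = i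

section Pattern

variable {N a b : ℕ}

theorem patternLabel_one_three (j : ℕ) :
    (patternLabel a b 1 3 j = 0 ↔
      2 * a + 2 ≤ j ∧ j < 2 * a + 2 * b + 3 ∧ j % 2 = 0 ∧ 2 ≤ j) ∧
    (patternLabel a b 1 3 j = 1 ↔
      j = 1 ∨ 2 * a + 2 ≤ j ∧ j < 2 * a + 2 * b + 3 ∧ j % 2 = 1) ∧
    (patternLabel a b 1 3 j = 2 ↔ j = 0 ∨ 2 ≤ j ∧ j < 2 * a + 2 ∧ j % 2 = 0) ∧
    (patternLabel a b 1 3 j = 3 ↔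
      2 ≤ j ∧ j < 2 * a + 2 ∧ j % 2 = 1 ∨ 2 * a + 2 * b + 3 ≤ j) := by
  rw [patternLabel]
  split_ifs <;> simp <;> omega

theorem patternLabel_zero_two (j : ℕ) :
    (patternLabel a b 0 2 j = 0 ↔
      j = 1 ∨ 2 * a + 2 ≤ j ∧ j < 2 * a + 2 * b + 3 ∧ j % 2 = 0) ∧
    (patternLabel a b 0 2 j = 1 ↔
      2 * a + 2 ≤ j ∧ j < 2 * a + 2 * b + 3 ∧ j % 2 = 1 ∧ 2 ≤ j) ∧
    (patternLabel a b 0 2 j = 2 ↔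
      j = 0 ∨ 2 ≤ j ∧ j < 2 * a + 2 ∧ j % 2 = 0 ∨ 2 * a + 2 * b + 3 ≤ j) ∧
    (patternLabel a b 0 2 j = 3 ↔ 2 ≤ j ∧ j < 2 * a + 2 ∧ j % 2 = 1) := by
  rw [patternLabel]
  split_ifs <;> simp <;> omega

theorem patternLabel_one_three_proper (i : Fin 4) (j : ℕ)
    (hj : j + 1 < 2 * a + 2 * b + 4) (h : patternLabel a b 1 3 j = i) :
    ¬ patternLabel a b 1 3 (j + 1) = i := by
  obtain ⟨h0, h1, h2, h3⟩ := patternLabel_one_three (a := a) (b := b) j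
  obtain ⟨k0, k1, k2, k3⟩ := patternLabel_one_three (a := a) (b := b) (j + 1)
  fin_cases i
  · replace h := h0.1 h; exact fun k => by replace k := k0.1 k; omega
  · replace h := h1.1 h; exact fun k => by replace k := k1.1 k; omega
  · replace h := h2.1 h; exact fun k => by replace k := k2.1 k; omega
  · replace h := h3.1 h; exact fun k => by replace k := k3.1 k; omega

/-- For `a = 0` the edges 1 and 2 would both have label 0. -/
theorem patternLabel_zero_two_proper (ha : 1 ≤ a) (i : Fin 4) (j : ℕ)
    (hj : j + 1 < 2 * a + 2 * b + 4) (h : patternLabel a b 0 2 j = i) :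
    ¬ patternLabel a b 0 2 (j + 1) = i := by
  obtain ⟨h0, h1, h2, h3⟩ := patternLabel_zero_two (a := a) (b := b) j
  obtain ⟨k0, k1, k2, k3⟩ := patternLabel_zero_two (a := a) (b := b) (j + 1)
  fin_cases i
  · replace h := h0.1 h; exact fun k => by replace k := k0.1 k; omega
  · replace h := h1.1 h; exact fun k => by replace k := k1.1 k; omega
  · replace h := h2.1 h; exact fun k => by replace k := k2.1 k; omega
  · replace h := h3.1 h; exact fun k => by replace k := k3.1 k; omega

theorem matchingPerm_pattern_apply {x y : Fin 4}
    (hp : ∀ (i : Fin 4) (j : ℕ), j + 1 < N → patternLabel a b x y j = i →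
      ¬ patternLabel a b x y (j + 1) = i) (i : Fin 4) (q : Fin (N + 1)) :
    (q.val < N ∧ patternLabel a b x y q = i ∧ (patternPerm N a b x y i q : ℕ) = q + 1) ∨
    (0 < q.val ∧ patternLabel a b x y (q - 1) = i ∧
      (patternPerm N a b x y i q : ℕ) + 1 = q) ∨
    (¬ (q.val < N ∧ patternLabel a b x y q = i) ∧
      ¬ (0 < q.val ∧ patternLabel a b x y (q - 1) = i) ∧
      (patternPerm N a b x y i q : ℕ) = q) := by
  have hv : (patternPerm N a b x y i q : ℕ) = _ :=
    matchingPerm_apply_val (E := fun j => patternLabel a b x y j = i) (hp i) q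
  split_ifs at hv with h1 h2
  · exact Or.inl ⟨h1.1, h1.2, hv⟩
  · exact Or.inr (Or.inl ⟨h2.1, h2.2, by omega⟩)
  · exact Or.inr (Or.inr ⟨h1, h2, hv⟩)

theorem patternPerm_one_three_apply (hN : N = 2 * a + 2 * b + 4)
    (q : Fin (N + 1)) :
    ((2 * a + 2 ≤ q.val ∧ q < N ∧
        (q.val % 2 = 0 ∧ (patternPerm N a b 1 3 0 q : ℕ) = q + 1 ∨
        q.val % 2 = 1 ∧ (patternPerm N a b 1 3 0 q : ℕ) + 1 = q)) ∨
      (q.val < 2 * a + 2 ∨ q.val = N) ∧ (patternPerm N a b 1 3 0 q : ℕ) = q) ∧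
    (q.val = 1 ∧ (patternPerm N a b 1 3 1 q : ℕ) = 2 ∨
      q.val = 2 ∧ (patternPerm N a b 1 3 1 q : ℕ) = 1 ∨
      (2 * a + 3 ≤ q.val ∧ q + 1 < N ∧
        (q.val % 2 = 1 ∧ (patternPerm N a b 1 3 1 q : ℕ) = q + 1 ∨
        q.val % 2 = 0 ∧ (patternPerm N a b 1 3 1 q : ℕ) + 1 = q)) ∨
      q.val ≠ 1 ∧ q.val ≠ 2 ∧ (q.val < 2 * a + 3 ∨ N ≤ q.val + 1) ∧
        (patternPerm N a b 1 3 1 q : ℕ) = q) ∧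
    ((q.val < 2 * a + 2 ∧
        (q.val % 2 = 0 ∧ (patternPerm N a b 1 3 2 q : ℕ) = q + 1 ∨
        q.val % 2 = 1 ∧ (patternPerm N a b 1 3 2 q : ℕ) + 1 = q)) ∨
      2 * a + 2 ≤ q.val ∧ (patternPerm N a b 1 3 2 q : ℕ) = q) ∧
    ((3 ≤ q.val ∧ q.val ≤ 2 * a + 2 ∧
        (q.val % 2 = 1 ∧ (patternPerm N a b 1 3 3 q : ℕ) = q + 1 ∨
        q.val % 2 = 0 ∧ (patternPerm N a b 1 3 3 q : ℕ) + 1 = q)) ∨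
      q.val = N ∧ (patternPerm N a b 1 3 3 q : ℕ) + 1 = N ∨
      q.val + 1 = N ∧ (patternPerm N a b 1 3 3 q : ℕ) = N ∨
      (q.val < 3 ∨ 2 * a + 2 < q.val ∧ q.val + 1 < N) ∧
        (patternPerm N a b 1 3 3 q : ℕ) = q) := by
  have hv := fun i : Fin 4 => matchingPerm_pattern_apply (N := N) (a := a) (b := b) (x := 1) (y := 3)
    (fun i j hj => patternLabel_one_three_proper i j (by omega)) i q
  have hq := q.2
  obtain ⟨h0, h1, h2, h3⟩ := patternLabel_one_three (a := a) (b := b) q.val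
  obtain ⟨k0, k1, k2, k3⟩ := patternLabel_one_three (a := a) (b := b) (q.val - 1)
  have v0 := hv 0
  have v1 := hv 1
  have v2 := hv 2
  have v3 := hv 3
  rw [h0, k0] at v0
  rw [h1, k1] at v1
  rw [h2, k2] at v2
  rw [h3, k3] at v3
  clear h0 h1 h2 h3 k0 k1 k2 k3
  subst hN
  refine ⟨?_, ?_, ?_, ?_⟩
  · clear v1 v2 v3; omega
  · clear v0 v2 v3; omega
  · clear v1 v0 v3; omega
  · clear v1 v2 v0; omega

theorem patternPerm_zero_two_apply (ha : 1 ≤ a) (hN : N = 2 * a + 2 * b + 4)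
    (q : Fin (N + 1)) :
    (q.val = 1 ∧ (patternPerm N a b 0 2 0 q : ℕ) = 2 ∨
      q.val = 2 ∧ (patternPerm N a b 0 2 0 q : ℕ) = 1 ∨
      (2 * a + 2 ≤ q.val ∧ q < N ∧
        (q.val % 2 = 0 ∧ (patternPerm N a b 0 2 0 q : ℕ) = q + 1 ∨
        q.val % 2 = 1 ∧ (patternPerm N a b 0 2 0 q : ℕ) + 1 = q)) ∨
      (q.val = 0 ∨ 3 ≤ q.val ∧ q.val < 2 * a + 2 ∨ q.val = N) ∧
        (patternPerm N a b 0 2 0 q : ℕ) = q) ∧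
    ((2 * a + 3 ≤ q.val ∧ q + 1 < N ∧
        (q.val % 2 = 1 ∧ (patternPerm N a b 0 2 1 q : ℕ) = q + 1 ∨
        q.val % 2 = 0 ∧ (patternPerm N a b 0 2 1 q : ℕ) + 1 = q)) ∨
      (q.val < 2 * a + 3 ∨ N ≤ q.val + 1) ∧ (patternPerm N a b 0 2 1 q : ℕ) = q) ∧
    ((q.val < 2 * a + 2 ∧
        (q.val % 2 = 0 ∧ (patternPerm N a b 0 2 2 q : ℕ) = q + 1 ∨
        q.val % 2 = 1 ∧ (patternPerm N a b 0 2 2 q : ℕ) + 1 = q)) ∨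
      q.val = N ∧ (patternPerm N a b 0 2 2 q : ℕ) + 1 = N ∨
      q.val + 1 = N ∧ (patternPerm N a b 0 2 2 q : ℕ) = N ∨
      2 * a + 2 ≤ q.val ∧ q.val + 1 < N ∧ (patternPerm N a b 0 2 2 q : ℕ) = q) ∧
    ((3 ≤ q.val ∧ q.val ≤ 2 * a + 2 ∧
        (q.val % 2 = 1 ∧ (patternPerm N a b 0 2 3 q : ℕ) = q + 1 ∨
        q.val % 2 = 0 ∧ (patternPerm N a b 0 2 3 q : ℕ) + 1 = q)) ∨
      (q.val < 3 ∨ 2 * a + 2 < q.val) ∧ (patternPerm N a b 0 2 3 q : ℕ) = q) := by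
  have hv := fun i : Fin 4 => matchingPerm_pattern_apply (N := N) (a := a) (b := b) (x := 0) (y := 2)
    (fun i j hj => patternLabel_zero_two_proper ha i j (by omega)) i q
  have hq := q.2
  obtain ⟨h0, h1, h2, h3⟩ := patternLabel_zero_two (a := a) (b := b) q.val
  obtain ⟨k0, k1, k2, k3⟩ := patternLabel_zero_two (a := a) (b := b) (q.val - 1)
  have v0 := hv 0
  have v1 := hv 1
  have v2 := hv 2
  have v3 := hv 3
  rw [h0, k0] at v0
  rw [h1, k1] at v1
  rw [h2, k2] at v2
  rw [h3, k3] at v3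
  clear h0 h1 h2 h3 k0 k1 k2 k3
  subst hN
  refine ⟨?_, ?_, ?_, ?_⟩
  · clear v1 v2 v3; omega
  · clear v0 v2 v3; omega
  · clear v1 v0 v3; omega
  · clear v1 v2 v0; omega

end Pattern

/-! ### Squares of products of two generators -/

/-- The hypothesis says that the component of `q` under `σ` and `τ` has at most two points, on which
one of them is trivial; there `σ * τ` has order at most two. -/
theorem Equiv.Perm.mul_mul_mul_apply_eq_self {α : Type*} {σ τ : Equiv.Perm α} (hσ : σ * σ = 1)
    (hτ : τ * τ = 1) {q : α}
    (h : (τ q = q ∧ τ (σ q) = σ q) ∨ (σ q = q ∧ σ (τ q) = τ q)) :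
    (σ * τ * (σ * τ)) q = q := by
  have hσ' : σ (σ q) = q := DFunLike.congr_fun hσ q
  have hτ' : τ (τ q) = q := DFunLike.congr_fun hτ q
  simp only [Equiv.Perm.mul_apply]
  rcases h with ⟨h1, h2⟩ | ⟨h1, h2⟩
  · rw [h1, h2, hσ']
  · rw [h2, hτ', h1]

section Pattern

variable {N a b : ℕ}

/-- Away from the stretch of vertices `2, …, 2a + 2`, the only edges labelled 2 or 3 are the first
and the last edge of the path, both isolated. -/
theorem patternPerm_one_three_lower_apply_eq_self (ha : 1 ≤ a) (hN : N = 2 * a + 2 * b + 4)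
    (hs : ∀ i, patternPerm N a b 1 3 i * patternPerm N a b 1 3 i = 1)
    (q : Fin (N + 1)) (hq : q.val < 2 ∨ 2 * a + 2 < q.val) :
    (patternPerm N a b 1 3 2 * patternPerm N a b 1 3 3 *
      (patternPerm N a b 1 3 2 * patternPerm N a b 1 3 3)) q = q := by
  refine Equiv.Perm.mul_mul_mul_apply_eq_self (hs 2) (hs 3) ?_
  have hv := patternPerm_one_three_apply hN
  have h1 := (hv q).2.2.1
  have h2 := (hv q).2.2.2
  have h3 := (hv (patternPerm N a b 1 3 2 q)).2.2.2
  have h4 := (hv (patternPerm N a b 1 3 3 q)).2.2.1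
  simp only [Fin.ext_iff]
  have := q.2
  omega

/-- Away from the stretch `2a + 2, …, N - 1`, the only edge labelled 0 or 1 is the isolated edge
`{1, 2}`. -/
theorem patternPerm_one_three_upper_apply_eq_self (ha : 1 ≤ a) (hN : N = 2 * a + 2 * b + 4)
    (hs : ∀ i, patternPerm N a b 1 3 i * patternPerm N a b 1 3 i = 1)
    (q : Fin (N + 1)) (hq : q.val < 2 * a + 2 ∨ N ≤ q.val) :
    (patternPerm N a b 1 3 0 * patternPerm N a b 1 3 1 *
      (patternPerm N a b 1 3 0 * patternPerm N a b 1 3 1)) q = q := by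
  refine Equiv.Perm.mul_mul_mul_apply_eq_self (hs 0) (hs 1) ?_
  have hv := patternPerm_one_three_apply hN
  have h1 := (hv q).1
  have h2 := (hv q).2.1
  have h3 := (hv (patternPerm N a b 1 3 0 q)).2.1
  have h4 := (hv (patternPerm N a b 1 3 1 q)).1
  simp only [Fin.ext_iff]
  have := q.2
  omega

theorem patternPerm_zero_two_lower_apply_eq_self (ha : 1 ≤ a) (hN : N = 2 * a + 2 * b + 4)
    (hs : ∀ i, patternPerm N a b 0 2 i * patternPerm N a b 0 2 i = 1)
    (q : Fin (N + 1)) (hq : q.val < 2 ∨ 2 * a + 2 < q.val) :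
    (patternPerm N a b 0 2 2 * patternPerm N a b 0 2 3 *
      (patternPerm N a b 0 2 2 * patternPerm N a b 0 2 3)) q = q := by
  refine Equiv.Perm.mul_mul_mul_apply_eq_self (hs 2) (hs 3) ?_
  have hv := patternPerm_zero_two_apply ha hN
  have h1 := (hv q).2.2.1
  have h2 := (hv q).2.2.2
  have h3 := (hv (patternPerm N a b 0 2 2 q)).2.2.2
  have h4 := (hv (patternPerm N a b 0 2 3 q)).2.2.1
  simp only [Fin.ext_iff]
  have := q.2
  omega

theorem patternPerm_zero_two_upper_apply_eq_self (ha : 1 ≤ a) (hN : N = 2 * a + 2 * b + 4)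
    (hs : ∀ i, patternPerm N a b 0 2 i * patternPerm N a b 0 2 i = 1)
    (q : Fin (N + 1)) (hq : q.val < 2 * a + 2 ∨ N ≤ q.val) :
    (patternPerm N a b 0 2 0 * patternPerm N a b 0 2 1 *
      (patternPerm N a b 0 2 0 * patternPerm N a b 0 2 1)) q = q := by
  refine Equiv.Perm.mul_mul_mul_apply_eq_self (hs 0) (hs 1) ?_
  have hv := patternPerm_zero_two_apply ha hN
  have h1 := (hv q).1
  have h2 := (hv q).2.1
  have h3 := (hv (patternPerm N a b 0 2 0 q)).2.1
  have h4 := (hv (patternPerm N a b 0 2 1 q)).1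
  simp only [Fin.ext_iff]
  have := q.2
  omega

theorem patternPerm_one_three_lower_apply_ne (ha : 1 ≤ a) (hN : N = 2 * a + 2 * b + 4) :
    (patternPerm N a b 1 3 2 * patternPerm N a b 1 3 3 * (patternPerm N a b 1 3 2 * patternPerm N a b 1 3 3))
      ⟨2 * a + 2, by omega⟩ ≠ ⟨2 * a + 2, by omega⟩ := by
  have hv := patternPerm_one_three_apply hN
  have e1 : patternPerm N a b 1 3 3 ⟨2 * a + 2, by omega⟩ = ⟨2 * a + 1, by omega⟩ := by
    have := (hv ⟨2 * a + 2, by omega⟩).2.2.2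
    ext
    simp only at this ⊢
    omega
  have e2 : patternPerm N a b 1 3 2 ⟨2 * a + 1, by omega⟩ = ⟨2 * a, by omega⟩ := by
    have := (hv ⟨2 * a + 1, by omega⟩).2.2.1
    ext
    simp only at this ⊢
    omega
  -- No exact value here: the generator 3 fixes `2a` when `a = 1` and lowers it otherwise. Either
  -- way the final image stays below `2a + 2`.
  have h1 := (hv ⟨2 * a, by omega⟩).2.2.2
  have h2 := (hv (patternPerm N a b 1 3 3 ⟨2 * a, by omega⟩)).2.2.1
  simp only [Equiv.Perm.mul_apply, e1, e2, ne_eq, Fin.ext_iff]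
  simp only at h1
  omega

theorem patternPerm_one_three_upper_apply_ne (ha : 1 ≤ a) (hb : 1 ≤ b)
    (hN : N = 2 * a + 2 * b + 4) :
    (patternPerm N a b 1 3 0 * patternPerm N a b 1 3 1 * (patternPerm N a b 1 3 0 * patternPerm N a b 1 3 1))
      ⟨2 * a + 2, by omega⟩ ≠ ⟨2 * a + 2, by omega⟩ := by
  have hv := patternPerm_one_three_apply hN
  have e1 : patternPerm N a b 1 3 1 ⟨2 * a + 2, by omega⟩ = ⟨2 * a + 2, by omega⟩ := by
    have := (hv ⟨2 * a + 2, by omega⟩).2.1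
    ext
    simp only at this ⊢
    omega
  have e2 : patternPerm N a b 1 3 0 ⟨2 * a + 2, by omega⟩ = ⟨2 * a + 3, by omega⟩ := by
    have := (hv ⟨2 * a + 2, by omega⟩).1
    ext
    simp only at this ⊢
    omega
  have e3 : patternPerm N a b 1 3 1 ⟨2 * a + 3, by omega⟩ = ⟨2 * a + 4, by omega⟩ := by
    have := (hv ⟨2 * a + 3, by omega⟩).2.1
    ext
    simp only at this ⊢
    omega
  have e4 : patternPerm N a b 1 3 0 ⟨2 * a + 4, by omega⟩ = ⟨2 * a + 5, by omega⟩ := by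
    have := (hv ⟨2 * a + 4, by omega⟩).1
    ext
    simp only at this ⊢
    omega
  simp only [Equiv.Perm.mul_apply, e1, e2, e3, e4, ne_eq, Fin.ext_iff]
  omega

theorem patternPerm_zero_two_lower_apply_ne (ha : 1 ≤ a) (hN : N = 2 * a + 2 * b + 4) :
    (patternPerm N a b 0 2 2 * patternPerm N a b 0 2 3 * (patternPerm N a b 0 2 2 * patternPerm N a b 0 2 3))
      ⟨2 * a + 2, by omega⟩ ≠ ⟨2 * a + 2, by omega⟩ := by
  have hv := patternPerm_zero_two_apply ha hN
  have e1 : patternPerm N a b 0 2 3 ⟨2 * a + 2, by omega⟩ = ⟨2 * a + 1, by omega⟩ := by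
    have := (hv ⟨2 * a + 2, by omega⟩).2.2.2
    ext
    simp only at this ⊢
    omega
  have e2 : patternPerm N a b 0 2 2 ⟨2 * a + 1, by omega⟩ = ⟨2 * a, by omega⟩ := by
    have := (hv ⟨2 * a + 1, by omega⟩).2.2.1
    ext
    simp only at this ⊢
    omega
  have h1 := (hv ⟨2 * a, by omega⟩).2.2.2
  have h2 := (hv (patternPerm N a b 0 2 3 ⟨2 * a, by omega⟩)).2.2.1
  simp only [Equiv.Perm.mul_apply, e1, e2, ne_eq, Fin.ext_iff]
  simp only at h1
  omega

theorem patternPerm_zero_two_upper_apply_ne (ha : 1 ≤ a) (hb : 1 ≤ b)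
    (hN : N = 2 * a + 2 * b + 4) :
    (patternPerm N a b 0 2 0 * patternPerm N a b 0 2 1 * (patternPerm N a b 0 2 0 * patternPerm N a b 0 2 1))
      ⟨2 * a + 2, by omega⟩ ≠ ⟨2 * a + 2, by omega⟩ := by
  have hv := patternPerm_zero_two_apply ha hN
  have e1 : patternPerm N a b 0 2 1 ⟨2 * a + 2, by omega⟩ = ⟨2 * a + 2, by omega⟩ := by
    have := (hv ⟨2 * a + 2, by omega⟩).2.1
    ext
    simp only at this ⊢
    omega
  have e2 : patternPerm N a b 0 2 0 ⟨2 * a + 2, by omega⟩ = ⟨2 * a + 3, by omega⟩ := by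
    have := (hv ⟨2 * a + 2, by omega⟩).1
    ext
    simp only at this ⊢
    omega
  have e3 : patternPerm N a b 0 2 1 ⟨2 * a + 3, by omega⟩ = ⟨2 * a + 4, by omega⟩ := by
    have := (hv ⟨2 * a + 3, by omega⟩).2.1
    ext
    simp only at this ⊢
    omega
  have e4 : patternPerm N a b 0 2 0 ⟨2 * a + 4, by omega⟩ = ⟨2 * a + 5, by omega⟩ := by
    have := (hv ⟨2 * a + 4, by omega⟩).1
    ext
    simp only at this ⊢
    omega
  simp only [Equiv.Perm.mul_apply, e1, e2, e3, e4, ne_eq, Fin.ext_iff]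
  omega

/-! ### Rigidity of the two patterns -/

/-- The path starts with labels 2, 1, 2, on which `s 1 * s 2` is a 4-cycle whose square reverses the
vertices 0 to 3. Elsewhere labels 1 and 2 are never adjacent. -/
theorem patternPerm_one_three_sq_apply (ha : 1 ≤ a) (hN : N = 2 * a + 2 * b + 4)
    (hs : ∀ i, patternPerm N a b 1 3 i * patternPerm N a b 1 3 i = 1) (q : Fin (N + 1)) :
    q.val < 4 ∧ ((patternPerm N a b 1 3 1 * patternPerm N a b 1 3 2 * (patternPerm N a b 1 3 1 * patternPerm N a b 1 3 2)) q : ℕ) + q = 3 ∨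
      4 ≤ q.val ∧ (patternPerm N a b 1 3 1 * patternPerm N a b 1 3 2 * (patternPerm N a b 1 3 1 * patternPerm N a b 1 3 2)) q = q := by
  have hv := patternPerm_one_three_apply hN
  by_cases hq : 4 ≤ q.val
  · refine Or.inr ⟨hq, Equiv.Perm.mul_mul_mul_apply_eq_self (hs 1) (hs 2) ?_⟩
    have h1 := (hv q).2.1
    have h2 := (hv q).2.2.1
    have h3 := (hv (patternPerm N a b 1 3 1 q)).2.2.1
    have h4 := (hv (patternPerm N a b 1 3 2 q)).2.1
    simp only [Fin.ext_iff]
    have := q.2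
    omega
  · refine Or.inl ⟨by omega, ?_⟩
    simp only [Equiv.Perm.mul_apply]
    have h1 := (hv q).2.2.1
    have h2 := (hv (patternPerm N a b 1 3 2 q)).2.1
    have h3 := (hv (patternPerm N a b 1 3 1 (patternPerm N a b 1 3 2 q))).2.2.1
    have h4 := (hv (patternPerm N a b 1 3 2 (patternPerm N a b 1 3 1 (patternPerm N a b 1 3 2 q)))).2.1
    have hq' : q.val = 0 ∨ q.val = 1 ∨ q.val = 2 ∨ q.val = 3 := by omega
    rcases hq' with hq' | hq' | hq' | hq' <;> omega

theorem patternPerm_one_three_kleinRigid (ha : 1 ≤ a) (hb : 1 ≤ b)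
    (hN : N = 2 * a + 2 * b + 4) (hs : ∀ i, patternPerm N a b 1 3 i * patternPerm N a b 1 3 i = 1) :
    SurfaceMap.KleinRigid (patternPerm N a b 1 3) := by
  have hv := patternPerm_one_three_apply hN
  set u := patternPerm N a b 1 3 1 * patternPerm N a b 1 3 2 * (patternPerm N a b 1 3 1 * patternPerm N a b 1 3 2) with hu
  have hu_apply : ∀ q : Fin (N + 1), q.val < 4 ∧ (u q : ℕ) + q = 3 ∨ 4 ≤ q.val ∧ u q = q :=
    patternPerm_one_three_sq_apply ha hN hs
  have huu : u * u = 1 := by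
    ext q
    have h1 := hu_apply q
    have h2 := hu_apply (u q)
    simp only [Fin.ext_iff] at h1 h2
    simp only [Equiv.Perm.mul_apply, Equiv.Perm.one_apply]
    omega
  have huu' : patternPerm N a b 1 3 1 * (patternPerm N a b 1 3 2 * (patternPerm N a b 1 3 1 * (patternPerm N a b 1 3 2 *
      (patternPerm N a b 1 3 1 * (patternPerm N a b 1 3 2 * (patternPerm N a b 1 3 1 * patternPerm N a b 1 3 2)))))) = 1 := by
    rw [← huu, hu]; simp only [mul_assoc]
  have p0 : patternPerm N a b 1 3 0 ⟨2 * a + 2, by omega⟩ = ⟨2 * a + 3, by omega⟩ := by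
    have := (hv ⟨2 * a + 2, by omega⟩).1
    ext
    simp only at this ⊢
    omega
  have w0 : patternPerm N a b 1 3 0 ⟨2 * a + 3, by omega⟩ = ⟨2 * a + 2, by omega⟩ := by
    have := (hv ⟨2 * a + 3, by omega⟩).1
    ext
    simp only at this ⊢
    omega
  have t0 : patternPerm N a b 1 3 0 ⟨2 * a + 1, by omega⟩ = ⟨2 * a + 1, by omega⟩ := by
    have := (hv ⟨2 * a + 1, by omega⟩).1
    ext
    simp only at this ⊢
    omega
  have p3 : patternPerm N a b 1 3 3 ⟨2 * a + 2, by omega⟩ = ⟨2 * a + 1, by omega⟩ := by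
    have := (hv ⟨2 * a + 2, by omega⟩).2.2.2
    ext
    simp only at this ⊢
    omega
  have w3 : patternPerm N a b 1 3 3 ⟨2 * a + 3, by omega⟩ = ⟨2 * a + 3, by omega⟩ := by
    have := (hv ⟨2 * a + 3, by omega⟩).2.2.2
    ext
    simp only at this ⊢
    omega
  have t3 : patternPerm N a b 1 3 3 ⟨2 * a + 1, by omega⟩ = ⟨2 * a + 2, by omega⟩ := by
    have := (hv ⟨2 * a + 1, by omega⟩).2.2.2
    ext
    simp only at this ⊢
    omega
  have c4 : patternPerm N a b 1 3 3 ⟨4, by omega⟩ = ⟨3, by omega⟩ := by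
    have := (hv ⟨4, by omega⟩).2.2.2
    ext
    simp only at this ⊢
    omega
  have c0 : patternPerm N a b 1 3 3 ⟨0, by omega⟩ = ⟨0, by omega⟩ := by
    have := (hv ⟨0, by omega⟩).2.2.2
    ext
    simp only at this ⊢
    omega
  have d3 : patternPerm N a b 1 3 1 ⟨3, by omega⟩ = ⟨3, by omega⟩ := by
    have := (hv ⟨3, by omega⟩).2.1
    ext
    simp only at this ⊢
    omega
  have f3 : patternPerm N a b 1 3 2 ⟨3, by omega⟩ = ⟨2, by omega⟩ := by
    have := (hv ⟨3, by omega⟩).2.2.1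
    ext
    simp only at this ⊢
    omega
  have d2 : patternPerm N a b 1 3 1 ⟨2, by omega⟩ = ⟨1, by omega⟩ := by
    have := (hv ⟨2, by omega⟩).2.1
    ext
    simp only at this ⊢
    omega
  have f1 : patternPerm N a b 1 3 2 ⟨1, by omega⟩ = ⟨0, by omega⟩ := by
    have := (hv ⟨1, by omega⟩).2.2.1
    ext
    simp only at this ⊢
    omega
  have d0 : patternPerm N a b 1 3 1 ⟨0, by omega⟩ = ⟨0, by omega⟩ := by
    have := (hv ⟨0, by omega⟩).2.1
    ext
    simp only at this ⊢
    omega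
  have f0 : patternPerm N a b 1 3 2 ⟨0, by omega⟩ = ⟨1, by omega⟩ := by
    have := (hv ⟨0, by omega⟩).2.2.1
    ext
    simp only at this ⊢
    omega
  have d1 : patternPerm N a b 1 3 1 ⟨1, by omega⟩ = ⟨2, by omega⟩ := by
    have := (hv ⟨1, by omega⟩).2.1
    ext
    simp only at this ⊢
    omega
  have f2 : patternPerm N a b 1 3 2 ⟨2, by omega⟩ = ⟨3, by omega⟩ := by
    have := (hv ⟨2, by omega⟩).2.2.1
    ext
    simp only at this ⊢
    omega
  have hcases : ∀ j : Fin 4, j ≠ 0 → j = 1 ∨ j = 2 ∨ j = 3 := by decide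
  intro j hj
  rcases hcases j hj with rfl | rfl | rfl
  -- Here `(s 1 * s 2)^4 = 1`, but translation by 1 or 2 turns it into a fourth power of a product
  -- of `s 0` and `s 3`, which is a 3-cycle on `2a + 1, 2a + 2, 2a + 3`.
  · refine ⟨[1, 2, 1, 2, 1, 2, 1, 2], by simpa using huu', fun h => ?_⟩
    replace h : patternPerm N a b 1 3 0 * (patternPerm N a b 1 3 3 * (patternPerm N a b 1 3 0 * (patternPerm N a b 1 3 3 *
      (patternPerm N a b 1 3 0 * (patternPerm N a b 1 3 3 * (patternPerm N a b 1 3 0 * patternPerm N a b 1 3 3)))))) = 1 := h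
    have := DFunLike.congr_fun h ⟨2 * a + 3, by omega⟩
    simp only [Equiv.Perm.mul_apply, Equiv.Perm.one_apply, p0, w0, t0, p3, w3, t3,
      Fin.ext_iff] at this
    omega
  · refine ⟨[1, 2, 1, 2, 1, 2, 1, 2], by simpa using huu', fun h => ?_⟩
    replace h : patternPerm N a b 1 3 3 * (patternPerm N a b 1 3 0 * (patternPerm N a b 1 3 3 * (patternPerm N a b 1 3 0 *
      (patternPerm N a b 1 3 3 * (patternPerm N a b 1 3 0 * (patternPerm N a b 1 3 3 * patternPerm N a b 1 3 0)))))) = 1 := h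
    have := DFunLike.congr_fun h ⟨2 * a + 2, by omega⟩
    simp only [Equiv.Perm.mul_apply, Equiv.Perm.one_apply, p0, w0, t0, p3, w3, t3,
      Fin.ext_iff] at this
    omega
  -- Translation by 3 swaps 1 and 2, so that relation survives. Instead `u` commutes with `s 0`,
  -- whose support avoids 0 to 3, but not with `s 3`, which swaps 3 and 4.
  · refine ⟨[1, 2, 1, 2, 0, 1, 2, 1, 2, 0], ?_, fun h => ?_⟩
    · have : u * patternPerm N a b 1 3 0 * (u * patternPerm N a b 1 3 0) = 1 := by
        ext1 q
        refine Equiv.Perm.mul_mul_mul_apply_eq_self huu (hs 0) ?_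
        have h1 := hu_apply q
        have h2 := (hv q).1
        have h3 := hu_apply (patternPerm N a b 1 3 0 q)
        have h4 := (hv (u q)).1
        simp only [Fin.ext_iff] at h1 h3 ⊢
        omega
      rw [← this, hu]
      simp only [List.map_cons, List.map_nil, List.prod_cons, List.prod_nil, mul_one, mul_assoc]
    · replace h : patternPerm N a b 1 3 2 * (patternPerm N a b 1 3 1 * (patternPerm N a b 1 3 2 * (patternPerm N a b 1 3 1 * (patternPerm N a b 1 3 3 *
        (patternPerm N a b 1 3 2 * (patternPerm N a b 1 3 1 * (patternPerm N a b 1 3 2 * (patternPerm N a b 1 3 1 * patternPerm N a b 1 3 3)))))))) = 1 := h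
      have := DFunLike.congr_fun h ⟨4, by omega⟩
      simp only [Equiv.Perm.mul_apply, Equiv.Perm.one_apply, c4, c0, d3, f3, d2, f1, d0, f0, d1,
        f2, Fin.ext_iff] at this
      omega

theorem patternPerm_zero_two_kleinRigid (ha : 1 ≤ a) (hb : 1 ≤ b)
    (hN : N = 2 * a + 2 * b + 4) (hs : ∀ i, patternPerm N a b 0 2 i * patternPerm N a b 0 2 i = 1) :
    SurfaceMap.KleinRigid (patternPerm N a b 0 2) := by
  have hv := patternPerm_zero_two_apply ha hN
  have h13 : patternPerm N a b 0 2 1 * patternPerm N a b 0 2 3 * (patternPerm N a b 0 2 1 * patternPerm N a b 0 2 3) = 1 := by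
    ext1 q
    refine Equiv.Perm.mul_mul_mul_apply_eq_self (hs 1) (hs 3) ?_
    have h1 := (hv q).2.1
    have h2 := (hv q).2.2.2
    have h3 := (hv (patternPerm N a b 0 2 1 q)).2.2.2
    have h4 := (hv (patternPerm N a b 0 2 3 q)).2.1
    simp only [Fin.ext_iff]
    omega
  have h21 : patternPerm N a b 0 2 2 * patternPerm N a b 0 2 1 * (patternPerm N a b 0 2 2 * patternPerm N a b 0 2 1) = 1 := by
    ext1 q
    refine Equiv.Perm.mul_mul_mul_apply_eq_self (hs 2) (hs 1) ?_
    have h1 := (hv q).2.2.1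
    have h2 := (hv q).2.1
    have h3 := (hv (patternPerm N a b 0 2 2 q)).2.1
    have h4 := (hv (patternPerm N a b 0 2 1 q)).2.2.1
    simp only [Fin.ext_iff]
    have := q.2
    omega
  rw [mul_assoc] at h13 h21
  have w0 : patternPerm N a b 0 2 0 ⟨2 * a + 3, by omega⟩ = ⟨2 * a + 2, by omega⟩ := by
    have := (hv ⟨2 * a + 3, by omega⟩).1
    ext
    simp only at this ⊢
    omega
  have t0 : patternPerm N a b 0 2 0 ⟨2 * a + 1, by omega⟩ = ⟨2 * a + 1, by omega⟩ := by
    have := (hv ⟨2 * a + 1, by omega⟩).1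
    ext
    simp only at this ⊢
    omega
  have p3 : patternPerm N a b 0 2 3 ⟨2 * a + 2, by omega⟩ = ⟨2 * a + 1, by omega⟩ := by
    have := (hv ⟨2 * a + 2, by omega⟩).2.2.2
    ext
    simp only at this ⊢
    omega
  have w3 : patternPerm N a b 0 2 3 ⟨2 * a + 3, by omega⟩ = ⟨2 * a + 3, by omega⟩ := by
    have := (hv ⟨2 * a + 3, by omega⟩).2.2.2
    ext
    simp only at this ⊢
    omega
  have c0 : patternPerm N a b 0 2 2 ⟨0, by omega⟩ = ⟨1, by omega⟩ := by
    have := (hv ⟨0, by omega⟩).2.2.1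
    ext
    simp only at this ⊢
    omega
  have c2 : patternPerm N a b 0 2 2 ⟨2, by omega⟩ = ⟨3, by omega⟩ := by
    have := (hv ⟨2, by omega⟩).2.2.1
    ext
    simp only at this ⊢
    omega
  have d0 : patternPerm N a b 0 2 0 ⟨0, by omega⟩ = ⟨0, by omega⟩ := by
    have := (hv ⟨0, by omega⟩).1
    ext
    simp only at this ⊢
    omega
  have d1 : patternPerm N a b 0 2 0 ⟨1, by omega⟩ = ⟨2, by omega⟩ := by
    have := (hv ⟨1, by omega⟩).1
    ext
    simp only at this ⊢
    omega
  have d3 : patternPerm N a b 0 2 0 ⟨3, by omega⟩ = ⟨3, by omega⟩ := by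
    have := (hv ⟨3, by omega⟩).1
    ext
    simp only at this ⊢
    omega
  have hcases : ∀ j : Fin 4, j ≠ 0 → j = 1 ∨ j = 2 ∨ j = 3 := by decide
  intro j hj
  -- `s 1` commutes with `s 3` and with `s 2`, while `s 0` commutes with neither `s 2` (labels 2, 0,
  -- 2 at the start) nor `s 3` (labels 3, 0 at `2a + 2`).
  rcases hcases j hj with rfl | rfl | rfl
  · refine ⟨[1, 3, 1, 3], by simpa using h13, fun h => ?_⟩
    replace h : patternPerm N a b 0 2 0 * (patternPerm N a b 0 2 2 * (patternPerm N a b 0 2 0 * patternPerm N a b 0 2 2)) = 1 := h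
    have := DFunLike.congr_fun h ⟨0, by omega⟩
    simp only [Equiv.Perm.mul_apply, Equiv.Perm.one_apply, c0, c2, d1, d3, Fin.ext_iff] at this
    omega
  · refine ⟨[2, 1, 2, 1], by simpa using h21, fun h => ?_⟩
    replace h : patternPerm N a b 0 2 0 * (patternPerm N a b 0 2 3 * (patternPerm N a b 0 2 0 * patternPerm N a b 0 2 3)) = 1 := h
    have := DFunLike.congr_fun h ⟨2 * a + 3, by omega⟩
    simp only [Equiv.Perm.mul_apply, Equiv.Perm.one_apply, w0, t0, p3, w3, Fin.ext_iff] at this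
    omega
  · refine ⟨[1, 3, 1, 3], by simpa using h13, fun h => ?_⟩
    replace h : patternPerm N a b 0 2 2 * (patternPerm N a b 0 2 0 * (patternPerm N a b 0 2 2 * patternPerm N a b 0 2 0)) = 1 := h
    have := DFunLike.congr_fun h ⟨0, by omega⟩
    simp only [Equiv.Perm.mul_apply, Equiv.Perm.one_apply, c0, c2, d0, d1, Fin.ext_iff] at this
    omega

end Pattern

/-! ### Permutation groups containing the alternating group -/

section PermutationGroups

variable {α : Type*} [Fintype α] [DecidableEq α]

/-- The commutator of two permutations whose supports meet in a single point is a 3-cycle. -/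
theorem Equiv.Perm.isThreeCycle_commutator_of_support_inter {x g : Equiv.Perm α} {p : α}
    (hx : x p ≠ p) (hg : g p ≠ p) (h : ∀ q, q ≠ p → x q = q ∨ g q = q) :
    (x * g * x⁻¹ * g⁻¹).IsThreeCycle := by
  have hxg : x (g p) = g p := (h (g p) hg).resolve_right fun e => hg (g.injective e)
  have hgp : x p ≠ g p := fun e => hg (x.injective (hxg.trans e.symm))
  set τ := Equiv.swap p (g p) with hτ
  have hττ : τ * τ = 1 := Equiv.swap_mul_self _ _
  -- Composing with `τ` makes `g` fix the common point `p`. Since `x` also fixes `g p`, nothing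
  -- moved by `x` is moved by `τ * g`.
  have hdisj : (τ * g).Disjoint x := by
    intro q
    by_cases hq : x q = q
    · exact Or.inr hq
    left
    rw [Equiv.Perm.mul_apply]
    by_cases hqp : q = p
    · rw [hqp, hτ, Equiv.swap_apply_right]
    · rw [(h q hqp).resolve_left hq, hτ, Equiv.swap_apply_of_ne_of_ne hqp]
      rintro rfl
      exact hq hxg
  have hcomm : τ * g * x = x * (τ * g) := hdisj.commute.eq
  have key : x * g * x⁻¹ * g⁻¹ = Equiv.swap (g p) (x p) * Equiv.swap (g p) p := by
    have h1 : x * τ * x⁻¹ = Equiv.swap (x p) (g p) := by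
      conv_rhs => rw [← hxg]
      rw [hτ, Equiv.swap_apply_apply]
    rw [Equiv.swap_comm (g p) (x p), Equiv.swap_comm (g p) p, ← h1, ← hτ]
    have h2 : g * x⁻¹ * g⁻¹ = τ * x⁻¹ * τ := by
      have h3 : g = τ * (τ * g) := by rw [← mul_assoc, hττ, one_mul]
      have h4 : τ⁻¹ = τ := inv_eq_of_mul_eq_one_left hττ
      have h5 : (τ * g) * x⁻¹ * (τ * g)⁻¹ = x⁻¹ := by
        rw [mul_inv_eq_iff_eq_mul, eq_inv_mul_iff_mul_eq, ← mul_assoc, ← hcomm]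
        group
      calc g * x⁻¹ * g⁻¹ = τ * ((τ * g) * x⁻¹ * (τ * g)⁻¹) * τ⁻¹ := by
            nth_rewrite 1 2 [h3]; group
        _ = τ * x⁻¹ * τ := by rw [h5, h4]
    calc x * g * x⁻¹ * g⁻¹ = x * (g * x⁻¹ * g⁻¹) := by group
      _ = x * τ * x⁻¹ * τ := by rw [h2]; group
  rw [key]
  exact Equiv.Perm.isThreeCycle_swap_mul_swap_same hgp.symm hg hx

theorem Subgroup.eq_top_of_alternatingGroup_le {G : Subgroup (Equiv.Perm α)}
    (hG : alternatingGroup α ≤ G) {σ : Equiv.Perm α} (hσ : σ ∈ G)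
    (hodd : Equiv.Perm.sign σ = -1) : G = ⊤ := by
  refine eq_top_iff.2 fun π _ => ?_
  rcases Int.units_eq_one_or (Equiv.Perm.sign π) with h | h
  · exact hG (Equiv.Perm.mem_alternatingGroup.2 h)
  · refine (Subgroup.mul_mem_cancel_left G hσ).1 (hG (Equiv.Perm.mem_alternatingGroup.2 ?_))
    rw [map_mul, h, hodd]
    decide

/-- A conjugating permutation of the wrong parity is corrected by the transposition of two fixed
points of `σ`. -/
theorem Subgroup.isConj_iff_cycleType_eq_of_alternatingGroup_le {G : Subgroup (Equiv.Perm α)}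
    (hG : alternatingGroup α ≤ G) {σ τ : G}
    (hσ : (σ : Equiv.Perm α).support.card + 2 ≤ Fintype.card α) :
    IsConj σ τ ↔ (σ : Equiv.Perm α).cycleType = (τ : Equiv.Perm α).cycleType := by
  constructor
  · intro h
    exact Equiv.Perm.isConj_iff_cycleType_eq.1 (G.subtype.map_isConj h)
  · intro h
    obtain ⟨π, hπ⟩ := isConj_iff.1 (Equiv.Perm.isConj_iff_cycleType_eq.2 h)
    have hcard : 1 < (σ : Equiv.Perm α).supportᶜ.card := by
      rw [Finset.card_compl]; omega
    obtain ⟨p, hp, q, hq, hpq⟩ := Finset.one_lt_card.1 hcard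
    rw [Finset.mem_compl, Equiv.Perm.notMem_support] at hp hq
    rcases Int.units_eq_one_or (Equiv.Perm.sign π) with h1 | h1
    · exact isConj_iff.2 ⟨⟨π, hG (Equiv.Perm.mem_alternatingGroup.2 h1)⟩, Subtype.ext hπ⟩
    · refine isConj_iff.2 ⟨⟨π * Equiv.swap p q, hG (Equiv.Perm.mem_alternatingGroup.2 ?_)⟩,
        Subtype.ext ?_⟩
      · rw [map_mul, h1, Equiv.Perm.sign_swap hpq]
        decide
      · change π * Equiv.swap p q * (σ : Equiv.Perm α) * (π * Equiv.swap p q)⁻¹ = τ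
        have : Equiv.swap p q * (σ : Equiv.Perm α) * (Equiv.swap p q)⁻¹ = σ := by
          rw [mul_inv_eq_iff_eq_mul, Equiv.mul_swap_eq_swap_mul, hp, hq]
        rw [← hπ, mul_inv_rev]
        nth_rewrite 2 [← this]
        group

/-- A group generated by elements that all change a two-colouring of the group by right
multiplication does not contain the alternating group, if one of the generators is even. -/
theorem not_exists_coloring_of_alternatingGroup_le {G : Subgroup (Equiv.Perm α)}
    (hG : alternatingGroup α ≤ G) {ι : Type*} {s : ι → G}
    (hs : ∀ i, s i * s i = 1) (hgen : Subgroup.closure (Set.range s) = ⊤) (i₀ : ι)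
    (heven : Equiv.Perm.sign (s i₀ : Equiv.Perm α) = 1) :
    ¬ ∃ χ : G → Bool, ∀ g i, χ (g * s i) ≠ χ g := by
  rintro ⟨χ, hχ⟩
  have flip : ∀ h : G, ∃ c : Bool, ∀ g, χ (g * h) = (c ^^ χ g) := by
    intro h
    obtain ⟨w, rfl⟩ := exists_word_of_involutions hs hgen h
    induction w with
    | nil => exact ⟨false, fun g => by simp⟩
    | cons i w ih =>
      obtain ⟨c, hc⟩ := ih
      refine ⟨!c, fun g => ?_⟩
      rw [List.map_cons, List.prod_cons, ← mul_assoc, hc, Bool.eq_not_of_ne (hχ g i)]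
      simp
  have sq : ∀ h g : G, χ (g * (h * h)) = χ g := by
    intro h g
    obtain ⟨c, hc⟩ := flip h
    rw [← mul_assoc, hc, hc]
    simp
  have key : ∀ σ ∈ alternatingGroup α, ∃ hσ : σ ∈ G, ∀ g : G, χ (g * ⟨σ, hσ⟩) = χ g := by
    intro σ hσ
    rw [← Equiv.Perm.closure_three_cycles_eq_alternating] at hσ
    induction hσ using Subgroup.closure_induction with
    | mem t ht =>
      replace ht : t.IsThreeCycle := ht
      have htG : t ∈ G := hG ht.mem_alternatingGroup
      refine ⟨htG, fun g => ?_⟩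
      have h3 : t ^ 3 = 1 := by rw [← ht.orderOf]; exact pow_orderOf_eq_one t
      -- A 3-cycle satisfies `t = t ^ 4`, a square, and squares preserve `χ`.
      have : (⟨t, htG⟩ : G) = (⟨t, htG⟩ * ⟨t, htG⟩) * (⟨t, htG⟩ * ⟨t, htG⟩) := by
        refine Subtype.ext ?_
        change t = t * t * (t * t)
        calc t = t ^ 3 * t := by rw [h3, one_mul]
          _ = t * t * (t * t) := by simp only [pow_succ, pow_zero, one_mul, mul_assoc]
      rw [this]
      exact sq _ g
    | one => exact ⟨G.one_mem, fun g => congrArg χ (mul_one g)⟩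
    | mul x y _ _ hx hy =>
      obtain ⟨hxG, hx⟩ := hx
      obtain ⟨hyG, hy⟩ := hy
      refine ⟨G.mul_mem hxG hyG, fun g => ?_⟩
      have : g * ⟨x * y, G.mul_mem hxG hyG⟩ = g * ⟨x, hxG⟩ * ⟨y, hyG⟩ :=
        Subtype.ext (mul_assoc _ _ _).symm
      rw [this, hy, hx]
    | inv x _ hx =>
      obtain ⟨hxG, hx⟩ := hx
      refine ⟨G.inv_mem hxG, fun g => ?_⟩
      rw [← hx (g * ⟨x⁻¹, G.inv_mem hxG⟩)]
      refine congrArg χ (Subtype.ext ?_)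
      exact inv_mul_cancel_right (g : Equiv.Perm α) x
  obtain ⟨_, h⟩ := key _ (Equiv.Perm.mem_alternatingGroup.2 heven)
  exact hχ 1 i₀ (h 1)

/-- Transitivity in prime degree gives primitivity, and the commutator of the two squares is the
3-cycle needed for Jordan's theorem. -/
theorem alternatingGroup_le_of_prime_card {s : Fin 4 → Equiv.Perm α} {p : α}
    (hprime : (Nat.card α).Prime)
    (htrans : MulAction.IsPretransitive (Subgroup.closure (Set.range s)) α)
    (hx : (s 2 * s 3 * (s 2 * s 3)) p ≠ p) (hg : (s 0 * s 1 * (s 0 * s 1)) p ≠ p)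
    (h : ∀ q, q ≠ p → (s 2 * s 3 * (s 2 * s 3)) q = q ∨ (s 0 * s 1 * (s 0 * s 1)) q = q) :
    alternatingGroup α ≤ Subgroup.closure (Set.range s) := by
  have hprim : MulAction.IsPreprimitive (Subgroup.closure (Set.range s)) α :=
    MulAction.IsPreprimitive.of_prime_card hprime
  have hmem : ∀ i, s i ∈ Subgroup.closure (Set.range s) :=
    fun i => Subgroup.subset_closure ⟨i, rfl⟩
  have h23 := mul_mem (mul_mem (hmem 2) (hmem 3)) (mul_mem (hmem 2) (hmem 3))
  have h01 := mul_mem (mul_mem (hmem 0) (hmem 1)) (mul_mem (hmem 0) (hmem 1))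
  exact Equiv.Perm.alternatingGroup_le_of_isPreprimitive_of_isThreeCycle_mem hprim
    (Equiv.Perm.isThreeCycle_commutator_of_support_inter hx hg h)
    (mul_mem (mul_mem (mul_mem h23 h01) (inv_mem h23)) (inv_mem h01))

theorem Equiv.Perm.mul_self_of_cycleType_eq_replicate_two {σ : Equiv.Perm α} {n : ℕ}
    (h : σ.cycleType = Multiset.replicate n 2) : σ * σ = 1 := by
  rw [← pow_two]
  refine orderOf_dvd_iff_pow_eq_one.1 ?_
  rw [← Equiv.Perm.lcm_cycleType, h]
  exact Multiset.lcm_dvd.2 fun b hb => (Multiset.eq_of_mem_replicate hb).dvd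

theorem Equiv.Perm.sign_of_cycleType_eq_replicate_two {σ : Equiv.Perm α} {n : ℕ}
    (h : σ.cycleType = Multiset.replicate n 2) : Equiv.Perm.sign σ = (-1) ^ n := by
  rw [Equiv.Perm.sign_of_cycleType', h]
  simp

end PermutationGroups

theorem isPretransitive_of_path {N : ℕ} {ι : Type*} {s : ι → Equiv.Perm (Fin (N + 1))}
    (h : ∀ j : Fin N, ∃ i, s i j.castSucc = j.succ) :
    MulAction.IsPretransitive (Subgroup.closure (Set.range s)) (Fin (N + 1)) := by
  have key : ∀ q : Fin (N + 1), ∃ g : Subgroup.closure (Set.range s), g • (0 : Fin (N + 1)) = q := by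
    intro q
    induction q using Fin.induction with
    | zero => exact ⟨1, one_smul _ _⟩
    | succ j ih =>
      obtain ⟨g, hg⟩ := ih
      obtain ⟨i, hi⟩ := h j
      refine ⟨⟨s i, Subgroup.subset_closure ⟨i, rfl⟩⟩ * g, ?_⟩
      rw [mul_smul, hg]
      exact hi
  refine ⟨fun x y => ?_⟩
  obtain ⟨g, rfl⟩ := key x
  obtain ⟨h, rfl⟩ := key y
  exact ⟨h * g⁻¹, by rw [mul_smul, inv_smul_smul]⟩

theorem ncard_range_eq_of_iff {ι β γ : Type*} {f : ι → β} {g : ι → γ}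
    (h : ∀ i j, f i = f j ↔ g i = g j) : (Set.range f).ncard = (Set.range g).ncard := by
  have hker : Setoid.ker f = Setoid.ker g := Setoid.ext fun i j => h i j
  rw [← Nat.card_coe_set_eq, ← Nat.card_coe_set_eq,
    ← Nat.card_congr (Setoid.quotientKerEquivRange f), hker,
    Nat.card_congr (Setoid.quotientKerEquivRange g)]

/-! ### The group of the labelled path -/

section PathPerm

variable {k m : ℕ}

theorem pathPerm_eq_patternPerm {a b : ℕ} {x y : Fin 4}
    (h : ∀ j < 4 * m, pathLabel k m (j + 1) = patternLabel a b x y j) :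
    pathPerm k m = patternPerm (4 * m) a b x y := by
  funext i
  rw [pathPerm_eq_matchingPerm]
  exact matchingPerm_congr fun j hj => by rw [h j hj]

theorem pathPerm_cycleType (hk : k ∈ Finset.Icc 1 4) (hm : PathAdmissible k m) (i : Fin 4) :
    (pathPerm k m i).cycleType = Multiset.replicate (pathParts k m i) 2 := by
  obtain ⟨a, b, ha, hb, hN, ⟨hl, hp⟩ | ⟨hl, hp⟩⟩ := exists_pattern hk hm
  · rw [pathPerm_eq_patternPerm hl, patternPerm, matchingPerm_cycleType
      (fun j hj => patternLabel_one_three_proper i j (by omega)), hp]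
    congr 1
    rw [hN, sum_patternLabel]
    fin_cases i <;> simp <;> omega
  · rw [pathPerm_eq_patternPerm hl, patternPerm, matchingPerm_cycleType
      (fun j hj => patternLabel_zero_two_proper ha i j (by omega)), hp]
    congr 1
    rw [hN, sum_patternLabel]
    fin_cases i <;> simp <;> omega

theorem pathPerm_mul_self (hk : k ∈ Finset.Icc 1 4) (hm : PathAdmissible k m) (i : Fin 4) :
    pathPerm k m i * pathPerm k m i = 1 :=
  Equiv.Perm.mul_self_of_cycleType_eq_replicate_two (pathPerm_cycleType hk hm i)

theorem pathPerm_ne_one (hk : k ∈ Finset.Icc 1 4) (hm : PathAdmissible k m) (i : Fin 4) :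
    pathPerm k m i ≠ 1 := by
  intro h
  have := pathPerm_cycleType hk hm i
  rw [h, Equiv.Perm.cycleType_one] at this
  have := congrArg Multiset.card this
  rw [Multiset.card_zero, Multiset.card_replicate] at this
  exact (hm.2.2 i).ne this

theorem pathPerm_kleinRigid (hk : k ∈ Finset.Icc 1 4) (hm : PathAdmissible k m) :
    SurfaceMap.KleinRigid (pathPerm k m) := by
  have hs := pathPerm_mul_self hk hm
  obtain ⟨a, b, ha, hb, hN, ⟨hl, -⟩ | ⟨hl, -⟩⟩ := exists_pattern hk hm <;>
    rw [pathPerm_eq_patternPerm hl] at hs ⊢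
  · exact patternPerm_one_three_kleinRigid ha hb hN hs
  · exact patternPerm_zero_two_kleinRigid ha hb hN hs

theorem alternatingGroup_le_closure_pathPerm (hk : k ∈ Finset.Icc 1 4)
    (hm : PathAdmissible k m) :
    alternatingGroup (Fin (4 * m + 1)) ≤ Subgroup.closure (Set.range (pathPerm k m)) := by
  have hs := pathPerm_mul_self hk hm
  have hprime : (Nat.card (Fin (4 * m + 1))).Prime := by
    rw [Nat.card_eq_fintype_card, Fintype.card_fin]
    exact hm.2.1
  have hsplit : ∀ a : ℕ, ∀ hp : 2 * a + 2 < 4 * m + 1, ∀ q : Fin (4 * m + 1),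
      q ≠ ⟨2 * a + 2, hp⟩ →
      (q.val < 2 ∨ 2 * a + 2 < q.val) ∨ (q.val < 2 * a + 2 ∨ 4 * m ≤ q.val) := by
    intro a hp q hq
    rw [ne_eq, Fin.ext_iff] at hq
    simp only at hq
    omega
  obtain ⟨a, b, ha, hb, hN, ⟨hl, -⟩ | ⟨hl, -⟩⟩ := exists_pattern hk hm <;>
    rw [pathPerm_eq_patternPerm hl] at hs ⊢
  · refine alternatingGroup_le_of_prime_card (p := ⟨2 * a + 2, by omega⟩) hprime
      (isPretransitive_of_path fun j => ⟨patternLabel a b 1 3 j, ?_⟩)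
      (patternPerm_one_three_lower_apply_ne ha hN)
      (patternPerm_one_three_upper_apply_ne ha hb hN) fun q hq => ?_
    · rw [patternPerm, matchingPerm_apply_of_edge
        (fun j hj => patternLabel_one_three_proper _ j (by omega)) j rfl _ (Or.inl rfl),
        Equiv.swap_apply_left]
    · exact (hsplit a _ q hq).imp (patternPerm_one_three_lower_apply_eq_self ha hN hs q)
        (patternPerm_one_three_upper_apply_eq_self ha hN hs q)
  · refine alternatingGroup_le_of_prime_card (p := ⟨2 * a + 2, by omega⟩) hprime
      (isPretransitive_of_path fun j => ⟨patternLabel a b 0 2 j, ?_⟩)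
      (patternPerm_zero_two_lower_apply_ne ha hN)
      (patternPerm_zero_two_upper_apply_ne ha hb hN) fun q hq => ?_
    · rw [patternPerm, matchingPerm_apply_of_edge
        (fun j hj => patternLabel_zero_two_proper ha _ j (by omega)) j rfl _ (Or.inl rfl),
        Equiv.swap_apply_left]
    · exact (hsplit a _ q hq).imp (patternPerm_zero_two_lower_apply_eq_self ha hN hs q)
        (patternPerm_zero_two_upper_apply_eq_self ha hN hs q)

theorem pathParts_odd_or_even (hk : k ∈ Finset.Icc 1 4) (hm : PathAdmissible k m) :
    (∀ i, Odd (pathParts k m i)) ∨ ∀ i, Even (pathParts k m i) := by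
  simp only [Nat.odd_iff, Nat.even_iff]
  obtain ⟨a, b, ha, hb, hN, ⟨-, hp⟩ | ⟨-, hp⟩⟩ := exists_pattern hk hm
  · rcases Nat.mod_two_eq_zero_or_one a with h | h
    · left; intro i; rw [hp]; fin_cases i <;> simp <;> omega
    · right; intro i; rw [hp]; fin_cases i <;> simp <;> omega
  · rcases Nat.mod_two_eq_zero_or_one a with h | h
    · right; intro i; rw [hp]; fin_cases i <;> simp <;> omega
    · left; intro i; rw [hp]; fin_cases i <;> simp <;> omega

theorem closure_pathPerm_eq_top (hk : k ∈ Finset.Icc 1 4) (hm : PathAdmissible k m)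
    (hodd : ∀ i, Odd (pathParts k m i)) :
    Subgroup.closure (Set.range (pathPerm k m)) = ⊤ :=
  Subgroup.eq_top_of_alternatingGroup_le (alternatingGroup_le_closure_pathPerm hk hm)
    (Subgroup.subset_closure ⟨0, rfl⟩) (by
      rw [Equiv.Perm.sign_of_cycleType_eq_replicate_two (pathPerm_cycleType hk hm 0),
        (hodd 0).neg_one_pow])

theorem closure_pathPerm_eq_alternatingGroup (hk : k ∈ Finset.Icc 1 4)
    (hm : PathAdmissible k m) (heven : ∀ i, Even (pathParts k m i)) :
    Subgroup.closure (Set.range (pathPerm k m)) = alternatingGroup (Fin (4 * m + 1)) := by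
  refine le_antisymm ((Subgroup.closure_le _).2 ?_) (alternatingGroup_le_closure_pathPerm hk hm)
  rintro _ ⟨i, rfl⟩
  refine Equiv.Perm.mem_alternatingGroup.2 ?_
  rw [Equiv.Perm.sign_of_cycleType_eq_replicate_two (pathPerm_cycleType hk hm i),
    (heven i).neg_one_pow]

/-- Provides the two fixed points required by the conjugacy criterion. -/
theorem card_support_pathPerm (hk : k ∈ Finset.Icc 1 4) (hm : PathAdmissible k m) (i : Fin 4) :
    (pathPerm k m i).support.card + 2 ≤ Fintype.card (Fin (4 * m + 1)) := by
  rw [← Equiv.Perm.sum_cycleType, pathPerm_cycleType hk hm, Multiset.sum_replicate,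
    Fintype.card_fin, smul_eq_mul]
  obtain ⟨a, b, ha, hb, hN, ⟨-, hp⟩ | ⟨-, hp⟩⟩ := exists_pattern hk hm <;>
    rw [hp] <;> fin_cases i <;> simp <;> omega

theorem ncard_range_pathParts (hk : k ∈ Finset.Icc 1 4) (hm : PathAdmissible k m) :
    (Set.range (pathParts k m)).ncard = k := by
  obtain ⟨h3, -, hpos⟩ := hm
  have hlast := hpos 3
  have hr : ∀ f : Fin 4 → ℕ, Set.range f = ((({f 0, f 1, f 2, f 3} : Finset ℕ)) : Set ℕ) := by
    intro f
    ext n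
    simp [Fin.exists_fin_succ, eq_comm]
  rw [hr, Set.ncard_coe_finset]
  rw [Finset.mem_Icc] at hk
  obtain ⟨hk1, hk4⟩ := hk
  interval_cases k <;> simp only [pathParts, Matrix.cons_val] at hlast ⊢
  · simp
  · have : m + 1 ≠ m - 1 := by omega
    simp [this]
  · rw [Finset.card_insert_of_notMem, Finset.insert_eq_of_mem, Finset.card_pair] <;> simp <;> omega
  · rw [Finset.card_insert_of_notMem, Finset.card_insert_of_notMem, Finset.card_pair] <;>
      simp <;> omega

/-! ### The map of the labelled path -/

/-- The generators of the group of the labelled path. -/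
def pathGen (k m : ℕ) (i : Fin 4) : Subgroup.closure (Set.range (pathPerm k m)) :=
  ⟨pathPerm k m i, Subgroup.subset_closure ⟨i, rfl⟩⟩

theorem pathGen_mul_self (hk : k ∈ Finset.Icc 1 4) (hm : PathAdmissible k m) (i : Fin 4) :
    pathGen k m i * pathGen k m i = 1 :=
  Subtype.ext (pathPerm_mul_self hk hm i)

theorem pathGen_ne_one (hk : k ∈ Finset.Icc 1 4) (hm : PathAdmissible k m) (i : Fin 4) :
    pathGen k m i ≠ 1 := fun h =>
  pathPerm_ne_one hk hm i (congrArg Subtype.val h)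

theorem closure_range_pathGen (k m : ℕ) : Subgroup.closure (Set.range (pathGen k m)) = ⊤ := by
  rw [← Subgroup.closure_closure_coe_preimage]
  congr 1
  ext g
  exact exists_congr fun i => Subtype.ext_iff

theorem pathGen_kleinRigid (hk : k ∈ Finset.Icc 1 4) (hm : PathAdmissible k m) :
    SurfaceMap.KleinRigid (pathGen k m) := by
  have hcoe : ∀ (f : Fin 4 → Fin 4) (w : List (Fin 4)),
      (((w.map fun i => pathGen k m (f i)).prod : Subgroup.closure (Set.range (pathPerm k m))) :
        Equiv.Perm (Fin (4 * m + 1))) = (w.map fun i => pathPerm k m (f i)).prod := by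
    intro f w
    rw [Subgroup.val_list_prod, List.map_map]
    rfl
  intro j hj
  obtain ⟨w, h1, h2⟩ := pathPerm_kleinRigid hk hm j hj
  refine ⟨w, Subtype.ext ((hcoe id w).trans h1), fun h => h2 ?_⟩
  rw [← hcoe, h]
  rfl

theorem isConj_pathGen_iff (hk : k ∈ Finset.Icc 1 4) (hm : PathAdmissible k m) (i j : Fin 4) :
    IsConj (pathGen k m i) (pathGen k m j) ↔ pathParts k m i = pathParts k m j := by
  rw [Subgroup.isConj_iff_cycleType_eq_of_alternatingGroup_le
    (alternatingGroup_le_closure_pathPerm hk hm) (card_support_pathPerm hk hm i)]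
  change (pathPerm k m i).cycleType = (pathPerm k m j).cycleType ↔ _
  rw [pathPerm_cycleType hk hm, pathPerm_cycleType hk hm]
  exact (Multiset.replicate_left_injective 2).eq_iff

/-- The map whose automorphism group is generated by the permutations of the labelled path. -/
def pathMap (hk : k ∈ Finset.Icc 1 4) (hm : PathAdmissible k m) : SurfaceMap :=
  SurfaceMap.ofInvolutions (pathGen k m) (pathGen_mul_self hk hm) (closure_range_pathGen k m)

theorem pathMap_isPathMap (hk : k ∈ Finset.Icc 1 4) (hm : PathAdmissible k m) :
    (pathMap hk hm).IsPathMap k m := by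
  have hs := pathGen_mul_self hk hm
  have hgen := closure_range_pathGen k m
  have hrig := pathGen_kleinRigid hk hm
  refine ⟨((1, 0) : _ × Fin 4), fun i => SurfaceMap.ofInvolutionsLeft hs hgen (pathGen k m i),
    fun i => ⟨(SurfaceMap.ofInvolutionsLeft_isReflection_iff hs hgen (pathGen_ne_one hk hm) _).2
      ⟨i, IsConj.refl _⟩, SurfaceMap.ofInvolutionsLeft_edgeFlags hs hgen i⟩,
    SurfaceMap.closure_range_ofInvolutionsLeft hs hgen hrig,
    (SurfaceMap.ofInvolutionsAutEquiv hs hgen hrig).symm, fun i => ?_⟩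
  exact congrArg Subtype.val
    ((SurfaceMap.ofInvolutionsAutEquiv hs hgen hrig).symm_apply_apply (pathGen k m i))

theorem pathMap_cr (hk : k ∈ Finset.Icc 1 4) (hm : PathAdmissible k m) :
    (pathMap hk hm).cr = k := by
  rw [pathMap, SurfaceMap.ofInvolutions_cr _ _ (pathGen_kleinRigid hk hm) (pathGen_ne_one hk hm)]
  refine Eq.trans ?_ (ncard_range_pathParts hk hm)
  exact ncard_range_eq_of_iff fun i j =>
    ConjClasses.mk_eq_mk_iff_isConj.trans (isConj_pathGen_iff hk hm i j)

theorem pathMap_orientable_iff (hk : k ∈ Finset.Icc 1 4) (hm : PathAdmissible k m) :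
    (pathMap hk hm).Orientable ↔ ∀ i, Odd (pathParts k m i) := by
  have hsign := fun i =>
    Equiv.Perm.sign_of_cycleType_eq_replicate_two (pathPerm_cycleType hk hm i)
  rw [pathMap, SurfaceMap.ofInvolutions_orientable_iff _ _ (pathGen_ne_one hk hm)]
  constructor
  · intro h
    refine (pathParts_odd_or_even hk hm).resolve_right fun heven => ?_
    exact not_exists_coloring_of_alternatingGroup_le
      (alternatingGroup_le_closure_pathPerm hk hm) (pathGen_mul_self hk hm)
      (closure_range_pathGen k m) 0 ((hsign 0).trans (heven 0).neg_one_pow) h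
  · intro hodd
    refine ⟨fun g => decide (Equiv.Perm.sign (g : Equiv.Perm (Fin (4 * m + 1))) = 1),
      fun g i => ?_⟩
    have : Equiv.Perm.sign ((g * pathGen k m i : Subgroup.closure (Set.range (pathPerm k m))) :
        Equiv.Perm (Fin (4 * m + 1))) =
        -Equiv.Perm.sign (g : Equiv.Perm (Fin (4 * m + 1))) := by
      change Equiv.Perm.sign ((g : Equiv.Perm (Fin (4 * m + 1))) * pathPerm k m i) = _
      rw [map_mul, hsign, (hodd i).neg_one_pow, mul_neg_one]
    simp only [this]
    rcases Int.units_eq_one_or (Equiv.Perm.sign (g : Equiv.Perm (Fin (4 * m + 1)))) with h | h <;>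
      rw [h] <;> decide

/-- Doubling avoids division in the order of the alternating group. -/
theorem two_mul_card_flag_pathMap (hk : k ∈ Finset.Icc 1 4) (hm : PathAdmissible k m) :
    2 * Nat.card (pathMap hk hm).Flag =
      (if Odd (pathParts k m 0) then 8 else 4) * (4 * m + 1).factorial := by
  have hfact : Nat.card (Equiv.Perm (Fin (4 * m + 1))) = (4 * m + 1).factorial := by
    rw [Nat.card_perm, Nat.card_eq_fintype_card, Fintype.card_fin]
  have hflag : Nat.card (pathMap hk hm).Flag =
      Nat.card (Subgroup.closure (Set.range (pathPerm k m))) * 4 := by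
    change Nat.card (Subgroup.closure (Set.range (pathPerm k m)) × Fin 4) = _
    rw [Nat.card_prod, Nat.card_eq_fintype_card (α := Fin 4), Fintype.card_fin]
  rw [hflag, ← hfact]
  rcases pathParts_odd_or_even hk hm with h | h
  · rw [closure_pathPerm_eq_top hk hm h, Subgroup.card_top, if_pos (h 0)]
    ring
  · have : Nontrivial (Fin (4 * m + 1)) := Fin.nontrivial_iff_two_le.2 (by have := hm.1; omega)
    rw [closure_pathPerm_eq_alternatingGroup hk hm h, if_neg (Nat.not_odd_iff_even.2 (h 0)),
      ← two_mul_nat_card_alternatingGroup]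
    ring

/-- With the parity fixed, the number of flags is a constant multiple of `(4m + 1)!`, which
determines `m`. -/
theorem not_isomorphic_pathMap {m' : ℕ} (hk : k ∈ Finset.Icc 1 4) (hm : PathAdmissible k m)
    (hm' : PathAdmissible k m') (hpar : Odd (pathParts k m 0) ↔ Odd (pathParts k m' 0))
    (hne : m ≠ m') : ¬ (pathMap hk hm).Isomorphic (pathMap hk hm') := by
  rintro ⟨f, -⟩
  have h := two_mul_card_flag_pathMap hk hm
  rw [Nat.card_congr f, two_mul_card_flag_pathMap hk hm', if_congr hpar rfl rfl] at h
  have h' := Nat.eq_of_mul_eq_mul_left (by split_ifs <;> norm_num) h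
  have h3 := hm'.1
  have := (Nat.factorial_inj (by omega)).1 h'
  omega

/-! ### Infinitely many admissible parameters of each parity -/

theorem pathAdmissible_of_lt {k m : ℕ} (h : 3 < m) (hp : (4 * m + 1).Prime) :
    PathAdmissible k m := by
  refine ⟨h.le, hp, fun i => ?_⟩
  rw [pathParts.eq_def]
  split <;> fin_cases i <;> simp <;> omega

theorem odd_pathParts_zero_iff (hk : k ∈ Finset.Icc 1 4) (m : ℕ) :
    Odd (pathParts k m 0) ↔ (k + m) % 2 = 0 := by
  rw [Nat.odd_iff]
  rw [Finset.mem_Icc] at hk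
  obtain ⟨hk1, hk4⟩ := hk
  interval_cases k <;> simp [pathParts] <;> omega

theorem infinite_pathAdmissible (k c : ℕ) :
    {m : ℕ | PathAdmissible k m ∧ (k + m) % 2 = c % 2}.Infinite := by
  refine Set.infinite_of_forall_exists_gt fun B => ?_
  -- A prime congruent to 1 or 5 modulo 8 is `4m + 1` with `m` even or odd respectively.
  have hr : ∃ r, r < 8 ∧ Nat.Coprime r 8 ∧ r % 4 = 1 ∧ (k + r / 4) % 2 = c % 2 := by
    rcases Nat.mod_two_eq_zero_or_one (k + c) with h | h
    · exact ⟨1, by norm_num, by norm_num, by norm_num, by omega⟩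
    · exact ⟨5, by norm_num, by norm_num, by norm_num, by omega⟩
  obtain ⟨r, hr8, hr, hr4, hrc⟩ := hr
  -- The bound `4 * B + 20` ensures that `p / 4` exceeds both `B` and 3.
  obtain ⟨p, hpB, hp, hpr⟩ := Nat.forall_exists_prime_gt_and_modEq (4 * B + 20)
    (by norm_num : (8 : ℕ) ≠ 0) hr
  have hpr' : p % 8 = r % 8 := hpr
  have h4 : 4 * (p / 4) + 1 = p := by omega
  refine ⟨p / 4, ⟨pathAdmissible_of_lt (by omega) (by rwa [h4]), by omega⟩, by omega⟩

end PathPerm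

/-! ### The main theorem -/

theorem pathMap_properties {k m : ℕ} (hk : k ∈ Finset.Icc 1 4) (hm : PathAdmissible k m) :
    (pathMap hk hm).IsCompact ∧ ¬ (pathMap hk hm).HasBoundary ∧
      (pathMap hk hm).JustEdgeTransitive ∧ (pathMap hk hm).cr = k :=
  ⟨SurfaceMap.ofInvolutions_isCompact _ _,
    SurfaceMap.ofInvolutions_not_hasBoundary _ _ (pathGen_ne_one hk hm),
    SurfaceMap.ofInvolutions_justEdgeTransitive _ _ (pathGen_kleinRigid hk hm),
    pathMap_cr hk hm⟩

theorem theorem5p1 (k : ℕ) (hk : k ∈ Finset.Icc 1 4) :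
    -- infinitely many orientable maps, and infinitely many non-orientable ones
    (∃ (m : ℕ → ℕ) (M : ℕ → SurfaceMap),
      (Pairwise fun i j => ¬ (M i).Isomorphic (M j)) ∧
      ∀ j, (M j).IsCompact ∧ ¬ (M j).HasBoundary ∧ (M j).JustEdgeTransitive ∧
        (M j).cr = k ∧ (M j).Orientable ∧
        PathAdmissible k (m j) ∧ (M j).IsPathMap k (m j)) ∧
    (∃ (m : ℕ → ℕ) (M : ℕ → SurfaceMap),
      (Pairwise fun i j => ¬ (M i).Isomorphic (M j)) ∧
      ∀ j, (M j).IsCompact ∧ ¬ (M j).HasBoundary ∧ (M j).JustEdgeTransitive ∧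
        (M j).cr = k ∧ ¬ (M j).Orientable ∧
        PathAdmissible k (m j) ∧ (M j).IsPathMap k (m j)) ∧
    -- the explicit family
    (∀ m : ℕ, PathAdmissible k m →
      (∀ i, (pathPerm k m i).cycleType = Multiset.replicate (pathParts k m i) 2) ∧
      ((∀ i, Odd (pathParts k m i)) ∧ Subgroup.closure (Set.range (pathPerm k m)) = ⊤ ∨
        (∀ i, Even (pathParts k m i)) ∧
          Subgroup.closure (Set.range (pathPerm k m)) = alternatingGroup (Fin (4 * m + 1))) ∧
      ∃ M : SurfaceMap, M.IsPathMap k m ∧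
        M.IsCompact ∧ ¬ M.HasBoundary ∧ M.JustEdgeTransitive ∧ M.cr = k ∧
        (M.Orientable ↔ ∀ i, Odd (pathParts k m i))) := by
  -- The parity of `c` selects the kind: even gives odd parts and orientable maps, odd gives even
  -- parts and non-orientable ones.
  have family : ∀ c : ℕ, ∃ (m : ℕ → ℕ) (hm : ∀ j, PathAdmissible k (m j)),
      (Pairwise fun i j => ¬ (pathMap hk (hm i)).Isomorphic (pathMap hk (hm j))) ∧
      ∀ j, Odd (pathParts k (m j) 0) ↔ c % 2 = 0 := by
    intro c
    have emb := (infinite_pathAdmissible k c).natEmbedding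
    have hpar : ∀ j, Odd (pathParts k (emb j) 0) ↔ c % 2 = 0 := fun j => by
      rw [odd_pathParts_zero_iff hk, (emb j).2.2]
    refine ⟨fun j => emb j, fun j => (emb j).2.1, fun i j hij => ?_, hpar⟩
    exact not_isomorphic_pathMap hk _ _ ((hpar i).trans (hpar j).symm)
      fun h => hij (emb.injective (Subtype.ext h))
  refine ⟨?_, ?_, fun m hm => ⟨pathPerm_cycleType hk hm, ?_, pathMap hk hm,
    pathMap_isPathMap hk hm, ?_⟩⟩
  · obtain ⟨m, hm, hiso, hodd⟩ := family 0
    refine ⟨m, fun j => pathMap hk (hm j), hiso, fun j => ?_⟩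
    obtain ⟨h1, h2, h3, h4⟩ := pathMap_properties hk (hm j)
    refine ⟨h1, h2, h3, h4, (pathMap_orientable_iff hk (hm j)).2 ?_, hm j,
      pathMap_isPathMap hk (hm j)⟩
    refine (pathParts_odd_or_even hk (hm j)).resolve_right fun heven => ?_
    exact Nat.not_odd_iff_even.2 (heven 0) ((hodd j).2 rfl)
  · obtain ⟨m, hm, hiso, hodd⟩ := family 1
    refine ⟨m, fun j => pathMap hk (hm j), hiso, fun j => ?_⟩
    obtain ⟨h1, h2, h3, h4⟩ := pathMap_properties hk (hm j)
    refine ⟨h1, h2, h3, h4, fun h => ?_, hm j, pathMap_isPathMap hk (hm j)⟩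
    exact absurd ((hodd j).1 ((pathMap_orientable_iff hk (hm j)).1 h 0)) (by norm_num)
  · exact (pathParts_odd_or_even hk hm).imp (fun h => ⟨h, closure_pathPerm_eq_top hk hm h⟩)
      fun h => ⟨h, closure_pathPerm_eq_alternatingGroup hk hm h⟩
  · obtain ⟨h1, h2, h3, h4⟩ := pathMap_properties hk hm
    exact ⟨h1, h2, h3, h4, pathMap_orientable_iff hk hm⟩
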